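/- Let $\mathbb D$ be an infinite set of data values. A finite data word over a finite alphabet $\mathbb A$ is a pair $w=(\mathbf a,\mathbf d)$ of maps $\mathbf a:\{1,\dots,n\}\to\mathbb A$ and $\mathbf d:\{1,\dots,n\}\to\mathbb D$ with $n\ge 1$. For an operator $\mathrm{op}\in\{\exists_<^\downarrow,\forall_\ge^\downarrow\}$, the formulas of the one-register logic $\mathsf{LTL}^\downarrow_{\mathsf{nnf}}(\mathsf F,\mathsf G,\mathrm{op})$ are given by $$\varphi ::= a \mid \lnot a \mid {\uparrow} \mid \lnot{\uparrow} \mid {\downarrow}\varphi \mid \mathsf F\varphi \mid \mathsf G\varphi \mid \mathrm{op}\,\varphi \mid \varphi\land\varphi \mid \varphi\lor\varphi \qquad (a\in\mathbb A).$$ Truth of $\varphi$ at position $i$ of $w$ with register content $d\in\mathbb D$, written $(w,i)\models^d\varphi$, is defined as follows (negated atoms and the Boolean connectives are interpreted as usual): - $(w,i)\models^d a$ iff $\mathbf a(i)=a$; - $(w,i)\models^d{\uparrow}$ iff $d=\mathbf d(i)$; - $(w,i)\models^d{\downarrow}\varphi$ iff $(w,i)\models^{\mathbf d(i)}\varphi$;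 - $(w,i)\models^d\mathsf F\varphi$ (resp. $\mathsf G\varphi$) iff $(w,j)\models^d\varphi$ for some (resp. every) $j$ with $i\le j\le n$; - $(w,i)\models^d\exists_<^\downarrow\varphi$ iff $(w,i)\models^{\mathbf d(j)}\varphi$ for some $j$ with $1\le j<i$; - $(w,i)\models^d\forall_\ge^\downarrow\varphi$ iff $(w,i)\models^{\mathbf d(j)}\varphi$ for every $j$ with $i\le j\le n$. The satisfiability problem asks, given a finite alphabet $\mathbb A$ and a formula $\varphi$ over $\mathbb A$, whether there is a finite data word $w$ over $\mathbb A$ and $\mathbb D$ with $(w,1)\models^{\mathbf d(1)}\varphi$. **Theorem.** (1) The satisfiability problem of $\mathsf{LTL}^\downarrow_{\mathsf{nnf}}(\mathsf F,\mathsf G,\exists_<^\downarrow)$ is undecidable. (2) The satisfiability problem of $\mathsf{LTL}^\downarrow_{\mathsf{nnf}}(\mathsf F,\mathsf G,\forall_\ge^\downarrow)$ is undecidable. -/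

import Mathlib

namespace RegLTL

/-- The two quantifiers over data values: `existsPast` is `∃_<^↓` (some data value occurring
strictly before the current position), `forallFuture` is `∀_≥^↓` (every data value occurring at
the current position or later). -/
inductive DataQuantifier
  | existsPast
  | forallFuture

/-- Formulas, in negation normal form, of linear temporal logic with one register and with the
operators `F`, `G` and `op`. Letters are natural numbers; the alphabet of size `n` is
`{0, …, n - 1}`. -/
inductive Formula (op : DataQuantifier) : Type
  | letter (a : ℕ) : Formula op
  | notLetter (a : ℕ) : Formula op
  /-- `↑` -/
  | test : Formula op
  /-- `¬↑` -/
  | notTest : Formula op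
  /-- `↓ φ` -/
  | freeze (φ : Formula op) : Formula op
  /-- `F φ` -/
  | future (φ : Formula op) : Formula op
  /-- `G φ` -/
  | globally (φ : Formula op) : Formula op
  /-- `op φ` -/
  | quant (φ : Formula op) : Formula op
  | and (φ ψ : Formula op) : Formula op
  | or (φ ψ : Formula op) : Formula op

/-- A finite data word with at least one position, over the alphabet `{0, …, n - 1}` and the
data domain `D`. -/
structure DataWord (n : ℕ) (D : Type*) where
  len : ℕ
  len_pos : 0 < len
  letter : Fin len → Fin n
  datum : Fin len → D

/-- The first position of a data word. -/
def DataWord.first {n : ℕ} {D : Type*} (w : DataWord n D) : Fin w.len := ⟨0, w.len_pos⟩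

/-- `op.Ranges w i P`: the property `P` of data values holds for some data value before, or for
every data value at or after, position `i`. -/
def DataQuantifier.Ranges {n : ℕ} {D : Type*} (op : DataQuantifier) (w : DataWord n D)
    (i : Fin w.len) (P : D → Prop) : Prop :=
  match op with
  | existsPast => ∃ j, j < i ∧ P (w.datum j)
  | forallFuture => ∀ j, i ≤ j → P (w.datum j)

namespace Formula

variable {op : DataQuantifier}

/-- `φ.Holds w i d`: the formula `φ` is true at position `i` of the data word `w` when the
register contains `d`. -/
def Holds {n : ℕ} {D : Type*} (w : DataWord n D) : Formula op → Fin w.len → D → Prop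
  | letter a, i, _ => (w.letter i : ℕ) = a
  | notLetter a, i, _ => (w.letter i : ℕ) ≠ a
  | test, i, d => d = w.datum i
  | notTest, i, d => d ≠ w.datum i
  | freeze φ, i, _ => φ.Holds w i (w.datum i)
  | future φ, i, d => ∃ j, i ≤ j ∧ φ.Holds w j d
  | globally φ, i, d => ∀ j, i ≤ j → φ.Holds w j d
  | quant φ, i, _ => op.Ranges w i fun d => φ.Holds w i d
  | and φ ψ, i, d => φ.Holds w i d ∧ ψ.Holds w i d
  | or φ ψ, i, d => φ.Holds w i d ∨ ψ.Holds w i d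

/-- All letters of the formula belong to the alphabet `{0, …, n - 1}`. -/
def OverAlphabet (n : ℕ) : Formula op → Prop
  | letter a => a < n
  | notLetter a => a < n
  | test => True
  | notTest => True
  | freeze φ => φ.OverAlphabet n
  | future φ => φ.OverAlphabet n
  | globally φ => φ.OverAlphabet n
  | quant φ => φ.OverAlphabet n
  | and φ ψ => φ.OverAlphabet n ∧ ψ.OverAlphabet n
  | or φ ψ => φ.OverAlphabet n ∧ ψ.OverAlphabet n

/-- The formula is true in some data word over `{0, …, n - 1}` and `D`, evaluated at the first
position with the first datum in the register. -/
def Satisfiable (D : Type*) (n : ℕ) (φ : Formula op) : Prop :=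
  ∃ w : DataWord n D, φ.Holds w w.first (w.datum w.first)

/-- Gödel number of a formula. -/
def toNat : Formula op → ℕ
  | test => 0
  | notTest => 1
  | letter a => 8 * a + 0 + 2
  | notLetter a => 8 * a + 1 + 2
  | freeze φ => 8 * φ.toNat + 2 + 2
  | future φ => 8 * φ.toNat + 3 + 2
  | globally φ => 8 * φ.toNat + 4 + 2
  | quant φ => 8 * φ.toNat + 5 + 2
  | and φ ψ => 8 * Nat.pair φ.toNat ψ.toNat + 6 + 2
  | or φ ψ => 8 * Nat.pair φ.toNat ψ.toNat + 7 + 2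

/-- The formula with a given Gödel number. -/
def ofNat (op : DataQuantifier) : ℕ → Formula op
  | 0 => test
  | 1 => notTest
  | k + 2 =>
    have h : k / 8 < k + 2 := by omega
    have h1 : (k / 8).unpair.1 < k + 2 := lt_of_le_of_lt (Nat.unpair_left_le _) h
    have h2 : (k / 8).unpair.2 < k + 2 := lt_of_le_of_lt (Nat.unpair_right_le _) h
    match k % 8 with
    | 0 => letter (k / 8)
    | 1 => notLetter (k / 8)
    | 2 => freeze (ofNat op (k / 8))
    | 3 => future (ofNat op (k / 8))
    | 4 => globally (ofNat op (k / 8))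
    | 5 => quant (ofNat op (k / 8))
    | 6 => and (ofNat op (k / 8).unpair.1) (ofNat op (k / 8).unpair.2)
    | _ => or (ofNat op (k / 8).unpair.1) (ofNat op (k / 8).unpair.2)

theorem ofNat_toNat (φ : Formula op) : ofNat op φ.toNat = φ := by
  have e (x r : ℕ) (hr : r < 8) : (8 * x + r) / 8 = x ∧ (8 * x + r) % 8 = r := by omega
  induction φ with
  | test => simp [toNat, ofNat]
  | notTest => simp [toNat, ofNat]
  | letter a => rw [toNat, ofNat]; simp
  | notLetter a => rw [toNat, ofNat]; simp [e a 1 (by omega)]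
  | freeze φ ih => rw [toNat, ofNat]; simp [e φ.toNat 2 (by omega), ih]
  | future φ ih => rw [toNat, ofNat]; simp [e φ.toNat 3 (by omega), ih]
  | globally φ ih => rw [toNat, ofNat]; simp [e φ.toNat 4 (by omega), ih]
  | quant φ ih => rw [toNat, ofNat]; simp [e φ.toNat 5 (by omega), ih]
  | and φ ψ ih1 ih2 =>
    rw [toNat, ofNat]; simp [e (Nat.pair φ.toNat ψ.toNat) 6 (by omega), ih1, ih2]
  | or φ ψ ih1 ih2 =>
    rw [toNat, ofNat]; simp [e (Nat.pair φ.toNat ψ.toNat) 7 (by omega), ih1, ih2]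

theorem toNat_ofNat (k : ℕ) : (ofNat op k).toNat = k := by
  induction k using Nat.strong_induction_on with
  | _ k ih =>
    match k with
    | 0 => simp [toNat, ofNat]
    | 1 => simp [toNat, ofNat]
    | k + 2 =>
      have h : k / 8 < k + 2 := by omega
      have i0 := ih _ h
      have i1 := ih _ (lt_of_le_of_lt (Nat.unpair_left_le (k / 8)) h)
      have i2 := ih _ (lt_of_le_of_lt (Nat.unpair_right_le (k / 8)) h)
      have hk := Nat.div_add_mod k 8
      have hlt := Nat.mod_lt k (show 8 > 0 by omega)
      rw [ofNat]
      generalize k % 8 = r at hk hlt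
      interval_cases r <;> simp only [toNat, i0, i1, i2, Nat.pair_unpair] <;> omega

/-- Formulas are identified with natural numbers through their Gödel numbers; this is the
encoding with respect to which computability is understood. -/
instance : Denumerable (Formula op) :=
  Denumerable.mk' ⟨toNat, ofNat op, ofNat_toNat, toNat_ofNat⟩

end Formula

/-- The satisfiability problem on finite data words with data domain `D`. The instances are
pairs of an alphabet `{0, …, n - 1}` and a formula over this alphabet. -/
def SatProblem (D : Type*) (op : DataQuantifier) (p : ℕ × Formula op) : Prop :=
  p.2.OverAlphabet p.1 ∧ p.2.Satisfiable D p.1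

end RegLTL

/-!
Halting of counter machines is reduced to satisfiability. A letter `visit l` announces each step of
a run, and its datum identifies the step: it is new, except that a decrement repeats the datum of
the increment that it cancels. After the announcement of the next step comes a letter `link l` with
the datum of the step at `l`; as no announcement of another step between the two may be that of a
node to which `l` does not lead, the steps follow one another as the machine prescribes. A zero test
is correct if every earlier increment of the counter is cancelled before the test. The freeze
quantifier together with `F` and `G` expresses all this, since it only concerns later positions.

The one condition that looks back is that a decrement has the datum of an earlier increment, and
this is where the additional operator is needed. With `∃_<^↓`, every datum that is not new has
occurred before. With `∀_≥^↓`, the first position ranges over all data values of the word and asks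
that a value with a decrement also has an increment; that the increment comes first is again a
condition on later positions.

Counter machines compute all partial recursive functions: counter programs with loops do, the
sequences of operations that such a program may perform form a regular language, and a finite
automaton for it serves as the machine.
-/

namespace RegLTL

/-! ### Closure properties of regular languages -/

section Regular

open Computability

variable {α : Type*} {L M : Language α}

theorem isRegular_of_finite (hL : Set.Finite (L : Set (List α))) : L.IsRegular := by
  rw [Language.isRegular_iff_finite_range_leftQuotient]
  have hs : (⋃ w ∈ (L : Set (List α)), {y : List α | y <:+ w}).Finite :=
    hL.biUnion fun w _ => w.tails.finite_toSet.subset fun y hy => by simpa using hy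
  refine hs.finite_subsets.subset ?_
  rintro _ ⟨x, rfl⟩ y hy
  exact Set.mem_biUnion (x := x ++ y) hy ⟨x, rfl⟩

theorem append_mem_mul_iff {x y : List α} :
    x ++ y ∈ L * M ↔
      y ∈ L.leftQuotient x * M ∨ ∃ a ∈ L, ∃ b, a ++ b = x ∧ y ∈ M.leftQuotient b := by
  simp only [Language.mem_mul, Language.mem_leftQuotient]
  constructor
  · rintro ⟨a, ha, b, hb, hab⟩
    rcases List.append_eq_append_iff.1 hab with ⟨c, rfl, rfl⟩ | ⟨c, rfl, rfl⟩
    exacts [.inr ⟨a, ha, c, rfl, hb⟩, .inl ⟨c, ha, b, hb, rfl⟩]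
  · rintro (⟨z, hz, m, hm, rfl⟩ | ⟨a, ha, b, rfl, hy⟩)
    exacts [⟨x ++ z, hz, m, hm, by simp⟩, ⟨a, ha, b ++ y, hy, by simp⟩]

theorem isRegular_mul (hL : L.IsRegular) (hM : M.IsRegular) : (L * M).IsRegular := by
  rw [Language.isRegular_iff_finite_range_leftQuotient] at *
  refine ((hL.prod hM.finite_subsets).image
    fun p : Language α × Set (Language α) => p.1 * M + ⨆ K : p.2, (K : Language α)).subset ?_
  rintro _ ⟨x, rfl⟩
  refine ⟨(L.leftQuotient x, {K | ∃ a ∈ L, ∃ b, a ++ b = x ∧ M.leftQuotient b = K}),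
    ⟨⟨x, rfl⟩, ?_⟩, ?_⟩
  · rintro _ ⟨a, -, b, -, rfl⟩
    exact ⟨b, rfl⟩
  · ext y
    rw [Language.mem_leftQuotient, append_mem_mul_iff]
    simp only [Language.mem_add, Language.mem_iSup]
    refine or_congr_right ⟨?_, ?_⟩
    · rintro ⟨⟨_, a, ha, b, hab, rfl⟩, hy⟩
      exact ⟨a, ha, b, hab, hy⟩
    · rintro ⟨a, ha, b, hab, hy⟩
      exact ⟨⟨_, a, ha, b, hab, rfl⟩, hy⟩

theorem append_mem_kstar {x y : List α} (hx : x ∈ L∗) (hy : y ∈ L∗) : x ++ y ∈ L∗ :=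
  kstar_mul_kstar L ▸ Language.append_mem_mul hx hy

theorem mem_kstar_of_mem {x : List α} (hx : x ∈ L) : x ∈ L∗ :=
  (le_kstar : L ≤ L∗) hx

theorem append_mem_kstar_iff {x y : List α} (hx : x ≠ []) :
    x ++ y ∈ L∗ ↔ ∃ a ∈ L∗, ∃ b, a ++ b = x ∧ y ∈ L.leftQuotient b * L∗ := by
  simp only [Language.mem_mul, Language.mem_leftQuotient]
  constructor
  · rintro ⟨S, hS, hSL⟩
    induction S generalizing x with
    | nil => simp_all
    | cons s S ih =>
      have hs := hSL s List.mem_cons_self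
      have hSL' : ∀ w ∈ S, w ∈ L := fun w hw => hSL w (List.mem_cons_of_mem s hw)
      rcases List.append_eq_append_iff.1 hS with ⟨c, rfl, rfl⟩ | ⟨c, rfl, hc⟩
      · exact ⟨[], Language.nil_mem_kstar L, x, rfl, c, hs, S.flatten, ⟨S, rfl, hSL'⟩, rfl⟩
      · rcases eq_or_ne c [] with rfl | hc'
        · exact ⟨[], Language.nil_mem_kstar L, s, by simp, [], by simpa using hs, S.flatten,
            ⟨S, rfl, hSL'⟩, by simpa using hc⟩
        · obtain ⟨a, ha, b, rfl, h⟩ := ih hc' hc.symm hSL'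
          exact ⟨s ++ a, append_mem_kstar (mem_kstar_of_mem hs) ha, b, by simp, h⟩
  · rintro ⟨a, ha, b, rfl, c, hc, z, hz, rfl⟩
    simpa using append_mem_kstar ha (append_mem_kstar (mem_kstar_of_mem hc) hz)

theorem isRegular_kstar (hL : L.IsRegular) : (L∗).IsRegular := by
  rw [Language.isRegular_iff_finite_range_leftQuotient] at *
  refine ((hL.finite_subsets.image
    fun p : Set (Language α) => (⨆ K : p, (K : Language α)) * L∗).union
    (Set.finite_singleton L∗)).subset ?_
  rintro _ ⟨x, rfl⟩
  rcases eq_or_ne x [] with rfl | hx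
  · exact .inr rfl
  refine .inl ⟨{K | ∃ a ∈ L∗, ∃ b, a ++ b = x ∧ L.leftQuotient b = K}, ?_, ?_⟩
  · rintro _ ⟨a, -, b, -, rfl⟩
    exact ⟨b, rfl⟩
  · ext y
    rw [Language.mem_leftQuotient, append_mem_kstar_iff hx]
    simp only [Language.mem_mul, Language.mem_iSup]
    constructor
    · rintro ⟨c, ⟨⟨_, a, ha, b, hab, rfl⟩, hc⟩, z, hz, hcz⟩
      exact ⟨a, ha, b, hab, c, hc, z, hz, hcz⟩
    · rintro ⟨a, ha, b, hab, c, hc, z, hz, hcz⟩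
      exact ⟨c, ⟨⟨_, a, ha, b, hab, rfl⟩, hc⟩, z, hz, hcz⟩

end Regular

/-! ### Counter programs -/

/-- Contents of countably many counters. -/
abbrev Counters := ℕ → ℕ

/-- Elementary operations on counters: increment, decrement of a nonzero counter, zero test. -/
inductive CounterOp
  | inc (r : ℕ)
  | dec (r : ℕ)
  | zero (r : ℕ)

open Function (update)

/-- The effect of an elementary operation. -/
def CounterOp.Step : CounterOp → Counters → Counters → Prop
  | inc r, v, v' => v' = update v r (v r + 1)
  | dec r, v, v' => v r ≠ 0 ∧ v' = update v r (v r - 1)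
  | zero r, v, v' => v r = 0 ∧ v' = v

/-- The effect of a sequence of elementary operations. -/
def Exec : List CounterOp → Counters → Counters → Prop
  | [], v, v' => v' = v
  | a :: w, v, v' => ∃ u, a.Step v u ∧ Exec w u v'

theorem exec_append {w₁ w₂ : List CounterOp} {v v' : Counters} :
    Exec (w₁ ++ w₂) v v' ↔ ∃ u, Exec w₁ v u ∧ Exec w₂ u v' := by
  induction w₁ generalizing v with
  | nil => simp [Exec]
  | cons a w ih =>
    simp only [List.cons_append, Exec, ih]
    constructor
    · rintro ⟨u, hu, x, hx, hv⟩; exact ⟨x, ⟨u, hu, hx⟩, hv⟩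
    · rintro ⟨x, ⟨u, hu, hx⟩, hv⟩; exact ⟨u, hu, x, hx, hv⟩

/-- Structured counter programs. `loop r p` decrements `r` and runs `p` as long as `r` is not
zero. -/
inductive Prog
  | skip
  | inc (r : ℕ)
  | seq (p q : Prog)
  | loop (r : ℕ) (p : Prog)

namespace Prog

/-- Input-output semantics of programs. -/
inductive BigStep : Prog → Counters → Counters → Prop
  | skip (v) : BigStep skip v v
  | inc (r v) : BigStep (inc r) v (update v r (v r + 1))
  | seq {p q v u v'} : BigStep p v u → BigStep q u v' → BigStep (seq p q) v v'
  | loopZero {r p v} : v r = 0 → BigStep (loop r p) v v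
  | loopSucc {r p v u v'} : v r ≠ 0 → BigStep p (update v r (v r - 1)) u →
      BigStep (loop r p) u v' → BigStep (loop r p) v v'

theorem BigStep.unique {p : Prog} {v v₁ v₂ : Counters} (h₁ : BigStep p v v₁)
    (h₂ : BigStep p v v₂) : v₁ = v₂ := by
  induction h₁ generalizing v₂ with
  | skip v => cases h₂; rfl
  | inc r v => cases h₂; rfl
  | seq _ _ ihp ihq =>
    cases h₂ with
    | seq hp hq => cases ihp hp; exact ihq hq
  | loopZero h =>
    cases h₂ with
    | loopZero => rfl
    | loopSucc h' => exact absurd h h'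
  | loopSucc h _ _ ihp ihl =>
    cases h₂ with
    | loopZero h' => exact absurd h' h
    | loopSucc _ hp hl => cases ihp hp; exact ihl hl

section Language

open Computability

/-- The language of the sequences of elementary operations that a program may perform. -/
def lang : Prog → Language CounterOp
  | skip => 1
  | inc r => {[CounterOp.inc r]}
  | seq p q => p.lang * q.lang
  | loop r p => ({[CounterOp.dec r]} * p.lang)∗ * {[CounterOp.zero r]}

theorem isRegular_lang (p : Prog) : p.lang.IsRegular := by
  have single (w : List CounterOp) : ({w} : Language CounterOp).IsRegular :=
    isRegular_of_finite (Set.finite_singleton w)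
  induction p with
  | skip => exact single []
  | inc r => exact single _
  | seq p q ihp ihq => exact isRegular_mul ihp ihq
  | loop r p ih => exact isRegular_mul (isRegular_kstar (isRegular_mul (single _) ih)) (single _)

/-- The elementary operations that occur in a program. -/
def ops : Prog → Set CounterOp
  | skip => ∅
  | inc r => {.inc r}
  | seq p q => p.ops ∪ q.ops
  | loop r p => {.dec r, .zero r} ∪ p.ops

theorem finite_ops (p : Prog) : p.ops.Finite := by
  induction p with
  | skip => exact Set.finite_empty
  | inc r => exact Set.finite_singleton _
  | seq p q ihp ihq => exact ihp.union ihq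
  | loop r p ih => exact (Set.toFinite _).union ih

theorem mem_ops_of_mem_lang {p : Prog} {w : List CounterOp} (hw : w ∈ p.lang) {a : CounterOp}
    (ha : a ∈ w) : a ∈ p.ops := by
  induction p generalizing w with
  | skip => obtain rfl := hw; cases ha
  | inc r => obtain rfl := hw; exact List.mem_singleton.1 ha
  | seq p q ihp ihq =>
    obtain ⟨x, hx, y, hy, rfl⟩ := hw
    exact (List.mem_append.1 ha).imp (ihp hx) (ihq hy)
  | loop r p ih =>
    obtain ⟨_, ⟨l, rfl, hl⟩, _, rfl, rfl⟩ := hw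
    rcases List.mem_append.1 ha with ha | ha
    · obtain ⟨x, hx, ha⟩ := List.mem_flatten.1 ha
      obtain ⟨_, rfl, y, hy, rfl⟩ := hl x hx
      exact (List.mem_append.1 ha).imp (fun ha => .inl (List.mem_singleton.1 ha)) (ih hy)
    · exact .inl (.inr (List.mem_singleton.1 ha))

theorem BigStep.exists_exec {p : Prog} {v v' : Counters} (h : BigStep p v v') :
    ∃ w ∈ p.lang, Exec w v v' := by
  induction h with
  | skip v => exact ⟨[], rfl, rfl⟩
  | inc r v => exact ⟨_, rfl, _, rfl, rfl⟩
  | seq _ _ ihp ihq =>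
    obtain ⟨x, hx, hx'⟩ := ihp
    obtain ⟨y, hy, hy'⟩ := ihq
    exact ⟨x ++ y, ⟨x, hx, y, hy, rfl⟩, exec_append.2 ⟨_, hx', hy'⟩⟩
  | @loopZero r p v h =>
    exact ⟨[.zero r], ⟨[], Language.nil_mem_kstar _, _, rfl, rfl⟩, v, ⟨h, rfl⟩, rfl⟩
  | @loopSucc r p v u v' h _ _ ihp ihl =>
    obtain ⟨x, hx, hx'⟩ := ihp
    obtain ⟨_, ⟨y, hy, _, rfl, rfl⟩, hy'⟩ := ihl
    have hdec : .dec r :: x ∈ ({[CounterOp.dec r]} * p.lang)∗ :=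
      mem_kstar_of_mem ⟨_, rfl, x, hx, rfl⟩
    refine ⟨(.dec r :: x ++ y) ++ [.zero r], ⟨_, append_mem_kstar hdec hy, _, rfl, rfl⟩, ?_⟩
    rw [List.append_assoc]
    exact ⟨_, ⟨h, rfl⟩, (exec_append (w₁ := x)).2 ⟨u, hx', hy'⟩⟩

theorem bigStep_of_exec {p : Prog} {w : List CounterOp} (hw : w ∈ p.lang) {v v' : Counters}
    (h : Exec w v v') : BigStep p v v' := by
  induction p generalizing v v' w with
  | skip => obtain rfl := hw; obtain rfl := h; exact .skip _
  | inc r =>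
    obtain rfl := hw
    obtain ⟨_, rfl, rfl⟩ := h
    exact .inc r v
  | seq p q ihp ihq =>
    obtain ⟨x, hx, y, hy, rfl⟩ := hw
    obtain ⟨u, h, h'⟩ := exec_append.1 h
    exact .seq (ihp hx h) (ihq hy h')
  | loop r p ih =>
    obtain ⟨_, ⟨l, rfl, hl⟩, _, rfl, rfl⟩ := hw
    induction l generalizing v with
    | nil =>
      obtain ⟨_, ⟨h, rfl⟩, rfl⟩ := h
      exact .loopZero h
    | cons x l ihl =>
      obtain ⟨_, rfl, x, hx, rfl⟩ := hl _ List.mem_cons_self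
      simp only [List.flatten_cons, List.append_assoc, List.singleton_append] at h
      obtain ⟨_, ⟨h0, rfl⟩, h⟩ := h
      obtain ⟨u, h1, h2⟩ := exec_append.1 h
      exact .loopSucc h0 (ih hx h1) (ihl (fun y hy => hl y (List.mem_cons_of_mem _ hy)) h2)

theorem bigStep_iff_exec {p : Prog} {v v' : Counters} :
    BigStep p v v' ↔ ∃ w ∈ p.lang, Exec w v v' :=
  ⟨BigStep.exists_exec, fun ⟨_, hw, h⟩ => bigStep_of_exec hw h⟩

end Language

theorem bigStep_loop {r n : ℕ} {p : Prog} (c : ℕ → Counters) (hn : c n r = 0)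
    (h : ∀ m < n, c m r ≠ 0 ∧ BigStep p (update (c m) r (c m r - 1)) (c (m + 1))) :
    BigStep (loop r p) (c 0) (c n) := by
  induction n generalizing c with
  | zero => exact .loopZero hn
  | succ n ih =>
    exact .loopSucc (h 0 n.succ_pos).1 (h 0 n.succ_pos).2
      (ih (fun m => c (m + 1)) hn fun m hm => h (m + 1) (Nat.succ_lt_succ hm))

theorem BigStep.exists_of_loop {r : ℕ} {p : Prog} {v v' : Counters}
    (h : BigStep (loop r p) v v') (c : ℕ → Counters) (h0 : c 0 = v)
    (hc : ∀ m, c m r ≠ 0 → BigStep p (update (c m) r (c m r - 1)) (c (m + 1))) :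
    ∃ n, c n r = 0 ∧ ∀ m < n, c m r ≠ 0 := by
  generalize hq : loop r p = q at h
  induction h generalizing c with
  | skip | inc | seq => cases hq
  | loopZero h =>
    cases hq
    exact ⟨0, h0 ▸ h, by simp⟩
  | loopSucc h hp _ _ ih =>
    cases hq
    subst h0
    obtain ⟨n, hn, hlt⟩ := ih (fun m => c (m + 1)) ((hc 0 h).unique hp) (fun m => hc (m + 1)) rfl
    exact ⟨n + 1, hn, fun m hm => m.casesOn (fun _ => h) (fun m hm => hlt m (by omega)) hm⟩

/-- Set a counter to zero. -/
def clear (a : ℕ) : Prog := loop a skip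

theorem bigStep_clear (a : ℕ) (v : Counters) : BigStep (clear a) v (update v a 0) := by
  have h := bigStep_loop (r := a) (p := skip) (n := v a) (fun m => update v a (v a - m)) (by simp)
    fun m hm => ⟨by simp; omega, by simpa [Nat.sub_sub] using BigStep.skip _⟩
  simpa [clear] using h

/-- Add counter `a` to counter `b`, with the help of a counter `t` that is initially zero. -/
def copy (a b t : ℕ) : Prog := seq (loop a (seq (inc b) (inc t))) (loop t (inc a))

theorem bigStep_copy {a b t : ℕ} (hab : a ≠ b) (hat : a ≠ t) (hbt : b ≠ t) {v : Counters}
    (ht : v t = 0) : BigStep (copy a b t) v (update v b (v b + v a)) := by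
  have hto := bigStep_loop (r := a) (p := seq (inc b) (inc t)) (n := v a)
    (fun m => update (update (update v b (v b + m)) t m) a (v a - m)) (by simp) fun m hm => by
      refine ⟨by simp; omega, ?_⟩
      convert BigStep.seq (.inc b _) (.inc t _) using 1
      grind [Function.update_apply]
  have hfrom := bigStep_loop (r := t) (p := inc a) (n := v a)
    (fun m => update (update (update v b (v b + v a)) t (v a - m)) a m) (by simp [hat.symm])
    fun m hm => by
      refine ⟨by simp [hat.symm]; omega, ?_⟩
      convert BigStep.inc a _ using 1
      grind [Function.update_apply]
  refine .seq (u := update (update (update v b (v b + v a)) t (v a)) a 0) ?_ ?_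
  · convert hto using 1 <;> grind [Function.update_apply]
  · convert hfrom using 1 <;> grind [Function.update_apply]

/-- Transfer the content of counter `a` to counter `b`, with the help of a counter `t` that is
initially zero. -/
def move (a b t : ℕ) : Prog := seq (clear b) (seq (copy a b t) (clear a))

theorem bigStep_move {a b t : ℕ} (hab : a ≠ b) (hat : a ≠ t) (hbt : b ≠ t) {v : Counters}
    (ht : v t = 0) : BigStep (move a b t) v (update (update v b (v a)) a 0) := by
  unfold move
  convert BigStep.seq (bigStep_clear b v) (.seq (bigStep_copy hab hat hbt ?_) (bigStep_clear a _))
    using 1 <;> grind [Function.update_apply]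

variable {n : ℕ}

/-- A partial function on tuples is programmable if, for all input counters `ins`, output counter
`o` and bound `b` on them, some program started with zero in `o` and in all counters from `b` on
writes the value to `o` and has no other effect, or runs forever where there is no value. -/
def Programmable (f : List.Vector ℕ n →. ℕ) : Prop :=
  ∀ (ins : List.Vector ℕ n) (o b : ℕ), (∀ r ∈ ins.toList, r < b) → o < b → o ∉ ins.toList →
    ∃ p : Prog, ∀ v : Counters, (∀ r ≥ b, v r = 0) → v o = 0 →
      ∀ v', BigStep p v v' ↔ ∃ y ∈ f (ins.map v), v' = update v o y

theorem programmable_lift_iff {f : List.Vector ℕ n → ℕ} :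
    Programmable (PFun.lift f) ↔
      ∀ (ins : List.Vector ℕ n) (o b : ℕ), (∀ r ∈ ins.toList, r < b) → o < b → o ∉ ins.toList →
        ∃ p : Prog, ∀ v : Counters, (∀ r ≥ b, v r = 0) → v o = 0 →
          BigStep p v (update v o (f (ins.map v))) := by
  refine forall₃_congr fun ins o b => forall₃_congr fun _ _ _ => exists_congr fun p =>
    forall₃_congr fun v _ _ => ?_
  simp only [PFun.lift, Part.mem_some_iff, exists_eq_left]
  exact ⟨fun h => (h _).2 rfl, fun h v' => ⟨fun h' => h'.unique h, fun h' => h' ▸ h⟩⟩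

theorem map_congr {ins : List.Vector ℕ n} {u v : Counters} (h : ∀ r ∈ ins.toList, u r = v r) :
    ins.map u = ins.map v :=
  List.Vector.eq _ _ (by simpa using h)

theorem map_update_of_notMem {ins : List.Vector ℕ n} {r : ℕ} (h : r ∉ ins.toList) (v : Counters)
    (a : ℕ) : ins.map (update v r a) = ins.map v :=
  map_congr fun _ hs => Function.update_of_ne (ne_of_mem_of_not_mem hs h) _ _

theorem programmable_zero : Programmable (PFun.lift fun _ : List.Vector ℕ n => 0) := by
  refine programmable_lift_iff.2 fun ins o b _ _ _ => ⟨skip, fun v _ ho => ?_⟩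
  rw [← ho, Function.update_eq_self]
  exact .skip v

theorem programmable_get (i : Fin n) :
    Programmable (PFun.lift fun a : List.Vector ℕ n => a.get i) := by
  refine programmable_lift_iff.2 fun ins o b hins ho hne =>
    ⟨copy (ins.get i) o b, fun v hb ho' => ?_⟩
  have hi := List.Vector.get_mem i ins
  simpa [ho'] using bigStep_copy (v := v) (ne_of_mem_of_not_mem hi hne) (hins _ hi).ne ho.ne
    (hb b le_rfl)

theorem programmable_succ : Programmable (PFun.lift fun a : List.Vector ℕ 1 => a.head.succ) := by
  refine programmable_lift_iff.2 fun ins o b hins ho hne =>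
    ⟨seq (copy ins.head o b) (inc o), fun v hb ho' => ?_⟩
  have hi : ins.head ∈ ins.toList := List.Vector.head_mem ..
  convert BigStep.seq (bigStep_copy (v := v) (ne_of_mem_of_not_mem hi hne) (hins _ hi).ne ho.ne
    (hb b le_rfl)) (.inc o _) using 1
  simp [ho', List.Vector.head_map]

/-- The counters `v` after the entries of a list have been stored in counter `b` and its
successors. -/
def writeFrom (v : Counters) (b : ℕ) : List ℕ → Counters
  | [] => v
  | a :: l => writeFrom (update v b a) (b + 1) l

theorem writeFrom_of_lt (v : Counters) {b r : ℕ} (l : List ℕ) (hr : r < b) :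
    writeFrom v b l r = v r := by
  induction l generalizing v b with
  | nil => rfl
  | cons a l ih => rw [writeFrom, ih _ (by omega), Function.update_of_ne (by omega)]

theorem writeFrom_of_le (v : Counters) {b r : ℕ} (l : List ℕ) (hr : b + l.length ≤ r) :
    writeFrom v b l r = v r := by
  induction l generalizing v b with
  | nil => rfl
  | cons a l ih =>
    rw [List.length_cons] at hr
    rw [writeFrom, ih _ (by omega), Function.update_of_ne (by omega)]

theorem writeFrom_replicate (v : Counters) {b n r a : ℕ} (hr : b ≤ r) (hrn : r < b + n) :
    writeFrom v b (List.replicate n a) r = a := by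
  induction n generalizing v b with
  | zero => omega
  | succ n ih =>
    rw [List.replicate_succ, writeFrom]
    rcases hr.eq_or_lt with rfl | hr
    · rw [writeFrom_of_lt _ _ b.lt_succ_self, Function.update_self]
    · exact ih _ hr (by omega)

theorem map_writeFrom_range' (v : Counters) (b : ℕ) (l : List ℕ) :
    (List.range' b l.length).map (writeFrom v b l) = l := by
  induction l generalizing v b with
  | nil => rfl
  | cons a l ih =>
    rw [List.length_cons, List.range'_succ, List.map_cons, writeFrom, ih,
      writeFrom_of_lt _ _ b.lt_succ_self, Function.update_self]

/-- Set `n` counters, from counter `b` on, to zero. -/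
def clearFrom (b : ℕ) : ℕ → Prog
  | 0 => skip
  | n + 1 => seq (clear b) (clearFrom (b + 1) n)

theorem bigStep_clearFrom (b n : ℕ) (v : Counters) :
    BigStep (clearFrom b n) v (writeFrom v b (List.replicate n 0)) := by
  induction n generalizing b v with
  | zero => exact .skip v
  | succ n ih => exact .seq (bigStep_clear b v) (ih _ _)

theorem exists_prog_mOfFn {m : ℕ} {g : Fin n → List.Vector ℕ m →. ℕ}
    (hg : ∀ i, Programmable (g i)) (ins : List.Vector ℕ m) {b : ℕ}
    (hins : ∀ r ∈ ins.toList, r < b) :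
    ∃ p : Prog, ∀ v : Counters, (∀ r ≥ b, v r = 0) → ∀ v', BigStep p v v' ↔
      ∃ y ∈ List.Vector.mOfFn fun i => g i (ins.map v), v' = writeFrom v b y.toList := by
  induction n generalizing b with
  | zero =>
    refine ⟨skip, fun v _ v' => ⟨fun h => ?_, ?_⟩⟩
    · cases h
      exact ⟨List.Vector.nil, Part.mem_some _, rfl⟩
    · rintro ⟨y, hy, rfl⟩
      rw [Part.mem_some_iff.1 hy]
      exact .skip v
  | succ n ih =>
    have hb : b ∉ ins.toList := fun h => (hins b h).false
    obtain ⟨p, hp⟩ := hg 0 ins b (b + 1) (fun r hr => (hins r hr).trans b.lt_succ_self)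
      b.lt_succ_self hb
    obtain ⟨q, hq⟩ := ih (fun i => hg i.succ) (b := b + 1)
      fun r hr => (hins r hr).trans b.lt_succ_self
    refine ⟨seq p q, fun v hv v' => ?_⟩
    have hp' := hp v (fun r hr => hv r (by omega)) (hv b le_rfl)
    have hq' (a : ℕ) := hq (update v b a) (fun r hr => by
      rw [Function.update_of_ne (by omega)]; exact hv r (by omega))
    simp only [map_update_of_notMem hb] at hq'
    simp only [List.Vector.mOfFn, Part.bind_eq_bind, Part.mem_bind_iff, Part.pure_eq_some,
      Part.mem_some_iff]
    constructor
    · rintro (_ | _ | ⟨h, h'⟩)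
      obtain ⟨a, ha, rfl⟩ := (hp' _).1 h
      obtain ⟨y, hy, rfl⟩ := (hq' a _).1 h'
      exact ⟨_, ⟨a, ha, y, hy, rfl⟩, by rw [List.Vector.toList_cons, writeFrom]⟩
    · rintro ⟨_, ⟨a, ha, y, hy, rfl⟩, rfl⟩
      rw [List.Vector.toList_cons, writeFrom]
      exact .seq ((hp' _).2 ⟨a, ha, rfl⟩) ((hq' a _).2 ⟨y, hy, rfl⟩)

theorem update_writeFrom_clear {v : Counters} {o b n : ℕ} (hv : ∀ r ≥ b, v r = 0) (ho : o < b)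
    (l : List ℕ) (hl : l.length = n) (z : ℕ) :
    writeFrom (update (writeFrom v b l) o z) b (List.replicate n 0) = update v o z := by
  funext r
  rcases lt_or_ge r b with hr | hr
  · simp only [writeFrom_of_lt _ _ hr, Function.update_apply]
  rw [Function.update_of_ne (by omega), hv r hr]
  rcases lt_or_ge r (b + n) with hr' | hr'
  · exact writeFrom_replicate _ hr hr'
  · rw [writeFrom_of_le _ _ (by simpa using hr'), Function.update_of_ne (by omega),
      writeFrom_of_le _ _ (hl ▸ hr'), hv r hr]

theorem programmable_comp {m : ℕ} {f : List.Vector ℕ n →. ℕ} {g : Fin n → List.Vector ℕ m →. ℕ}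
    (hf : Programmable f) (hg : ∀ i, Programmable (g i)) :
    Programmable fun a => (List.Vector.mOfFn fun i => g i a).bind f := by
  intro ins o b hins ho _
  obtain ⟨p, hp⟩ := exists_prog_mOfFn hg ins hins
  obtain ⟨q, hq⟩ := hf ⟨List.range' b n, List.length_range'⟩ o (b + n) (by simp) (by omega)
    (by simp; omega)
  refine ⟨seq p (seq q (clearFrom b n)), fun v hv ho' v' => ?_⟩
  have hq' (y : List.Vector ℕ n) := hq (writeFrom v b y.toList)
    (fun r hr => by
      rw [writeFrom_of_le _ _ (by simpa using hr)]; exact hv r (by omega))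
    (by rw [writeFrom_of_lt _ _ ho, ho'])
  have hmap (y : List.Vector ℕ n) : List.Vector.map (writeFrom v b y.toList)
      ⟨List.range' b n, List.length_range'⟩ = y := by
    have h := map_writeFrom_range' v b y.toList
    rw [y.toList_length] at h
    exact List.Vector.eq _ _ h
  have hclear (y : List.Vector ℕ n) (z : ℕ) : BigStep (clearFrom b n)
      (update (writeFrom v b y.toList) o z) (update v o z) :=
    update_writeFrom_clear hv ho y.toList y.toList_length z ▸ bigStep_clearFrom _ _ _
  simp only [hmap] at hq'
  constructor
  · rintro (_ | _ | ⟨h, _ | _ | ⟨h', h''⟩⟩)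
    obtain ⟨y, hy, rfl⟩ := (hp v hv _).1 h
    obtain ⟨z, hz, rfl⟩ := (hq' y _).1 h'
    exact ⟨z, Part.mem_bind_iff.2 ⟨y, hy, hz⟩, h''.unique (hclear y z)⟩
  · rintro ⟨z, hz, rfl⟩
    obtain ⟨y, hy, hz⟩ := Part.mem_bind_iff.1 hz
    exact .seq ((hp v hv _).2 ⟨y, hy, rfl⟩) (.seq ((hq' y _).2 ⟨z, hz, rfl⟩) (hclear y z))

theorem bigStep_prec_loop {R : ℕ → ℕ} {g : List.Vector ℕ (n + 2) → ℕ} {ins : List.Vector ℕ n}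
    {o b : ℕ} (hins : ∀ r ∈ ins.toList, r < b) (ho : o < b) (hne : o ∉ ins.toList) {q : Prog}
    (hq : ∀ v : Counters, (∀ r ≥ b + 3, v r = 0) → v (b + 2) = 0 →
      BigStep q v (update v (b + 2) (g (v (b + 1) ::ᵥ v o ::ᵥ ins.map v))))
    {v : Counters} (hv : ∀ r ≥ b, v r = 0)
    (hR : ∀ m, R (m + 1) = g (m ::ᵥ R m ::ᵥ ins.map v)) (N : ℕ) :
    BigStep (loop b (seq q (seq (move (b + 2) o (b + 3)) (inc (b + 1)))))
      (update (update v o (R 0)) b N) (update (update v o (R N)) (b + 1) N) := by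
  have h := bigStep_loop (r := b) (n := N)
    (p := seq q (seq (move (b + 2) o (b + 3)) (inc (b + 1))))
    (fun m => update (update (update v o (R m)) b (N - m)) (b + 1) m) (by simp) fun m hm => by
      refine ⟨by simp; omega, ?_⟩
      set u := update (update (update v o (R m)) b (N - (m + 1))) (b + 1) m
      have hmap : ins.map u = ins.map v := map_congr fun r hr => by
        have := hins r hr
        have := ne_of_mem_of_not_mem hr hne
        grind [Function.update_apply]
      have hq' := hq u (by grind [Function.update_apply]) (by grind [Function.update_apply])
      have hu1 : u (b + 1) = m := by grind [Function.update_apply]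
      have huo : u o = R m := by grind [Function.update_apply]
      rw [hmap, hu1, huo, ← hR] at hq'
      have hmove := bigStep_move (a := b + 2) (b := o) (t := b + 3) (by omega) (by omega) (by omega)
        (v := update u (b + 2) (R (m + 1))) (by grind [Function.update_apply])
      convert BigStep.seq hq' (.seq hmove (.inc (b + 1) _)) using 1 <;>
        grind [Function.update_apply]
  convert h using 1 <;> grind [Function.update_apply]

theorem programmable_prec {f : List.Vector ℕ n → ℕ} {g : List.Vector ℕ (n + 2) → ℕ}
    (hf : Programmable (PFun.lift f)) (hg : Programmable (PFun.lift g)) :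
    Programmable (PFun.lift fun a : List.Vector ℕ (n + 1) =>
      a.head.rec (f a.tail) fun m y => g (m ::ᵥ y ::ᵥ a.tail)) := by
  rw [programmable_lift_iff] at *
  intro ins o b hins ho hne
  obtain ⟨c, ins, rfl⟩ := ins.exists_eq_cons
  simp only [List.Vector.toList_cons, List.mem_cons, not_or, forall_eq_or_imp] at hins hne
  obtain ⟨p, hp⟩ := hf ins o b hins.2 ho hne.2
  obtain ⟨q, hq⟩ := hg ((b + 1) ::ᵥ o ::ᵥ ins) (b + 2) (b + 3)
    (by have := hins.2; simp; grind) (by omega) (by have := hins.2; simp; grind)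
  refine ⟨seq p (seq (copy c b (b + 1)) (seq (loop b (seq q (seq (move (b + 2) o (b + 3))
    (inc (b + 1))))) (clear (b + 1)))), fun v hv ho' => ?_⟩
  simp only [List.Vector.map_cons] at hq ⊢
  obtain ⟨R, hR⟩ : ∃ R : ℕ → ℕ,
      R = fun k => k.rec (f (ins.map v)) fun m y => g (m ::ᵥ y ::ᵥ ins.map v) := ⟨_, rfl⟩
  have hR0 : R 0 = f (ins.map v) := by subst hR; rfl
  have hRs (m : ℕ) : R (m + 1) = g (m ::ᵥ R m ::ᵥ ins.map v) := by subst hR; rfl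
  have hinit := hp v hv ho'
  rw [← hR0] at hinit
  have hcopy : BigStep (copy c b (b + 1)) (update v o (R 0))
      (update (update v o (R 0)) b (v c)) := by
    convert bigStep_copy (a := c) (b := b) (t := b + 1) (v := update v o (R 0)) hins.1.ne
      (by omega) (by omega) (by grind [Function.update_apply]) using 1
    grind [Function.update_apply]
  have hloop := bigStep_prec_loop hins.2 ho hne.2 hq hv hRs (v c)
  have hclear := bigStep_clear (b + 1) (update (update v o (R (v c))) (b + 1) (v c))
  have hout : update (update (update v o (R (v c))) (b + 1) (v c)) (b + 1) 0 =
      update v o (R (v c)) := by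
    grind [Function.update_apply]
  rw [hout] at hclear
  simpa [hR] using BigStep.seq hinit (.seq hcopy (.seq hloop hclear))

theorem programmable_rfind {f : List.Vector ℕ (n + 1) → ℕ} (hf : Programmable (PFun.lift f)) :
    Programmable fun a : List.Vector ℕ n =>
      Nat.rfind fun m => Part.some (decide (f (m ::ᵥ a) = 0)) := by
  intro ins o b hins ho _
  obtain ⟨p, hp⟩ := programmable_lift_iff.1 hf (b ::ᵥ ins) (b + 1) (b + 2)
    (by simp; grind) (by omega) (by simp; grind)
  refine ⟨seq p (seq (loop (b + 1) (seq (clear (b + 1)) (seq (inc b) p))) (move b o (b + 1))),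
    fun v hv _ v' => ?_⟩
  set c : ℕ → Counters := fun m => update (update v b m) (b + 1) (f (m ::ᵥ ins.map v)) with hc
  have hcounter (m : ℕ) : c m (b + 1) = f (m ::ᵥ ins.map v) := by simp [hc]
  have hbody (m : ℕ) : BigStep p (update v b m) (c m) := by
    have hb : b ∉ ins.toList := fun h => (hins b h).false
    simpa [List.Vector.map_cons, map_update_of_notMem hb] using
      hp (update v b m) (by grind [Function.update_apply]) (by grind [Function.update_apply])
  have hstart : BigStep p v (c 0) := by
    simpa [← hv b le_rfl] using hbody 0
  have hstep (m : ℕ) : BigStep (seq (clear (b + 1)) (seq (inc b) p))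
      (update (c m) (b + 1) (c m (b + 1) - 1)) (c (m + 1)) := by
    refine .seq (bigStep_clear _ _) (.seq (.inc b _) ?_)
    convert hbody (m + 1) using 1
    grind [Function.update_apply]
  have hrun {k : ℕ} (hk : c k (b + 1) = 0) (hlt : ∀ m < k, c m (b + 1) ≠ 0) :
      BigStep (seq p (seq (loop (b + 1) (seq (clear (b + 1)) (seq (inc b) p))) (move b o (b + 1))))
        v (update v o k) := by
    refine .seq hstart (.seq (bigStep_loop c hk fun m hm => ⟨hlt m hm, hstep m⟩) ?_)
    convert bigStep_move (a := b) (b := o) (t := b + 1) (by omega) (by omega) (by omega) hk using 1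
    grind [Function.update_apply]
  have hmem (k : ℕ) : (k ∈ Nat.rfind fun m => Part.some (decide (f (m ::ᵥ ins.map v) = 0))) ↔
      c k (b + 1) = 0 ∧ ∀ m < k, c m (b + 1) ≠ 0 :=
    Nat.mem_rfind.trans (by simp [hcounter])
  refine ⟨fun h => ?_, fun ⟨k, hk, h⟩ => ?_⟩
  · have h' := h
    obtain _ | _ | ⟨h1, _ | _ | ⟨h2, -⟩⟩ := h'
    obtain ⟨k, hk⟩ := h2.exists_of_loop c (hstart.unique h1) fun m _ => hstep m
    exact ⟨k, (hmem k).2 hk, h.unique (hrun hk.1 hk.2)⟩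
  · obtain ⟨hk, hlt⟩ := (hmem k).1 hk
    exact h ▸ hrun hk hlt

theorem programmable_of_primrec {f : List.Vector ℕ n → ℕ} (hf : Nat.Primrec' f) :
    Programmable (PFun.lift f) := by
  induction hf with
  | zero => exact programmable_zero
  | succ => exact programmable_succ
  | get i => exact programmable_get i
  | @comp m n f g _ _ ihf ihg =>
    have hcomp : (fun a => (List.Vector.mOfFn fun i => (PFun.lift (g i)) a).bind (PFun.lift f)) =
        PFun.lift fun a => f (List.Vector.ofFn fun i => g i a) := by
      funext a
      exact (congrArg (Part.bind · _) (List.Vector.mOfFn_pure _)).trans (Part.bind_some _ _)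
    exact hcomp ▸ programmable_comp ihf ihg
  | prec _ _ ihf ihg => exact programmable_prec ihf ihg

theorem programmable_of_partrec {f : List.Vector ℕ n →. ℕ} (hf : Nat.Partrec' f) :
    Programmable f := by
  induction hf with
  | prim hf => exact programmable_of_primrec hf
  | comp g _ _ ihf ihg => exact programmable_comp ihf ihg
  | rfind _ ih => exact programmable_rfind ih

theorem exists_prog_of_partrec {f : ℕ →. ℕ} (hf : Partrec f) :
    ∃ p : Prog, ∀ n, (∃ v', BigStep p (update 0 0 n) v') ↔ (f n).Dom := by
  obtain ⟨p, hp⟩ := programmable_of_partrec (Nat.Partrec'.part_iff₁.2 hf) (0 ::ᵥ .nil) 1 2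
    (by simp) (by simp) (by simp)
  refine ⟨p, fun n => ?_⟩
  have hpn := hp (update 0 0 n)
    (fun r hr => by rw [Function.update_of_ne (by omega)]; rfl) (by simp)
  simp [hpn, List.Vector.map_cons, Part.dom_iff_mem]

end Prog

/-! ### Counter machines -/

/-- A counter machine, given as a graph whose nodes carry elementary operations or, with `none`,
the instruction to halt. The node `init`, which increments counter `0`, serves to load the input
in the encoding of runs. -/
structure CounterGraph (Λ : Type) where
  instr : Λ → Option CounterOp
  next : Λ → Λ → Prop
  start : Λ → Prop
  init : Λ
  instr_init : instr init = some (.inc 0)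
  next_init : ∀ l, next init l

/-- The nodes of the counter machine of an automaton with states `σ` that reads operations in
`S`: the node that loads the input, the halting node, and the nodes that perform `a` in
state `s`. -/
inductive DFANode (σ : Type) (S : Set CounterOp)
  | load
  | accept
  | perform (s : σ) (a : S)

namespace CounterGraph

/-- The machine may halt when it is at node `l` with counters `v`. -/
inductive HaltsFrom {Λ : Type} (G : CounterGraph Λ) : Λ → Counters → Prop
  | halt {l v} : G.instr l = none → HaltsFrom G l v
  | step {l a v v' l'} : G.instr l = some a → a.Step v v' → G.next l l' → HaltsFrom G l' v' →
      HaltsFrom G l v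

/-- The machine may halt on input `n`. -/
def Halts {Λ : Type} (G : CounterGraph Λ) (n : ℕ) : Prop :=
  ∃ l, G.start l ∧ G.HaltsFrom l (update 0 0 n)

end CounterGraph

namespace DFANode

open CounterGraph

variable {σ : Type} {S : Set CounterOp}

instance [Finite σ] [Finite S] : Finite (DFANode σ S) :=
  Finite.of_surjective (fun x : Option (Option (σ × S)) => match x with
    | none => load
    | some none => accept
    | some (some (s, a)) => perform s a) fun l => match l with
    | load => ⟨none, rfl⟩
    | accept => ⟨some none, rfl⟩
    | perform s a => ⟨some (some (s, a)), rfl⟩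

/-- The node `l` may be entered when the automaton is in state `s`. -/
def At (M : DFA CounterOp σ) (s : σ) : DFANode σ S → Prop
  | load => False
  | accept => s ∈ M.accept
  | perform t _ => t = s

/-- The counter machine that performs the sequences of operations accepted by an automaton. -/
def toCounterGraph (M : DFA CounterOp σ) (S : Set CounterOp) : CounterGraph (DFANode σ S) where
  instr
    | load => some (.inc 0)
    | accept => none
    | perform _ a => some a
  next
    | load, _ => True
    | accept, _ => False
    | perform s a, l => At M (M.step s a) l
  start := At M M.start
  init := load
  instr_init := rfl
  next_init _ := trivial

theorem exists_accepted_of_haltsFrom {M : DFA CounterOp σ} {l : DFANode σ S} {v : Counters}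
    (h : (toCounterGraph M S).HaltsFrom l v) {s : σ} (hs : At M s l) :
    ∃ w v', M.evalFrom s w ∈ M.accept ∧ Exec w v v' := by
  induction h generalizing s with
  | @halt l v h =>
    cases l with
    | load => exact hs.elim
    | accept => exact ⟨[], v, hs, rfl⟩
    | perform => cases h
  | @step l a v v' l' h hstep hnext _ ih =>
    cases l with
    | load => exact hs.elim
    | accept => cases h
    | perform s a =>
      obtain rfl := Option.some.inj h
      obtain rfl := hs
      obtain ⟨w, u, hw, hu⟩ := ih hnext
      exact ⟨a :: w, u, hw, _, hstep, hu⟩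

theorem haltsFrom_of_accepted {M : DFA CounterOp σ} {w : List CounterOp} (hS : ∀ a ∈ w, a ∈ S)
    {s : σ} (hw : M.evalFrom s w ∈ M.accept) {v v' : Counters} (h : Exec w v v') :
    ∃ l, At M s l ∧ (toCounterGraph M S).HaltsFrom l v := by
  induction w generalizing s v with
  | nil => exact ⟨accept, hw, .halt rfl⟩
  | cons a w ih =>
    rw [List.forall_mem_cons] at hS
    obtain ⟨u, hstep, h⟩ := h
    obtain ⟨l, hl, hl'⟩ := ih hS.2 (s := M.step s a) hw h
    exact ⟨perform s ⟨a, hS.1⟩, rfl, .step rfl hstep hl hl'⟩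

theorem halts_toCounterGraph_iff {M : DFA CounterOp σ} (hS : ∀ w ∈ M.accepts, ∀ a ∈ w, a ∈ S)
    {n : ℕ} :
    (toCounterGraph M S).Halts n ↔ ∃ w ∈ M.accepts, ∃ v', Exec w (update 0 0 n) v' := by
  constructor
  · rintro ⟨l, hl, h⟩
    obtain ⟨w, v', hw, h⟩ := exists_accepted_of_haltsFrom h hl
    exact ⟨w, hw, v', h⟩
  · rintro ⟨w, hw, v', h⟩
    exact haltsFrom_of_accepted (hS w hw) hw h

end DFANode

theorem exists_counterGraph_not_computablePred_halts :
    ∃ (Λ : Type) (_ : Fintype Λ) (G : CounterGraph Λ), ¬ ComputablePred G.Halts := by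
  let f : ℕ →. ℕ := fun n => (Denumerable.ofNat Nat.Partrec.Code n).eval 0
  have hf : Partrec f :=
    Nat.Partrec.Code.eval_part.comp (Computable.ofNat _) (Computable.const 0)
  obtain ⟨p, hp⟩ := Prog.exists_prog_of_partrec hf
  obtain ⟨σ, _, M, hM⟩ := p.isRegular_lang
  have := p.finite_ops.fintype
  have hhalts (n : ℕ) : (DFANode.toCounterGraph M p.ops).Halts n ↔ (f n).Dom := by
    rw [DFANode.halts_toCounterGraph_iff fun w hw a => Prog.mem_ops_of_mem_lang (hM ▸ hw), hM,
      ← hp n]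
    simp only [Prog.bigStep_iff_exec]
    exact ⟨fun ⟨w, hw, v, h⟩ => ⟨v, w, hw, h⟩, fun ⟨v, w, hw, h⟩ => ⟨w, hw, v, h⟩⟩
  refine ⟨_, Fintype.ofFinite _, DFANode.toCounterGraph M p.ops,
    fun hc => ComputablePred.halting_problem 0 ?_⟩
  refine ComputablePred.computable_of_manyOneReducible ⟨Encodable.encode, Computable.encode,
    fun c => ?_⟩ hc
  rw [hhalts, show f (Encodable.encode c) = c.eval 0 by simp [f]]

/-! ### The formulas describing runs -/

/-- The letters of the data words that describe runs of a counter machine with nodes `Λ`. The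
step at a node `l` is announced by `visit l`; its datum is that of the increment to be cancelled
if `l` decrements a counter, and new otherwise. Once the following step has been announced, the
datum is repeated with the letter `link l`. -/
inductive RunLetter (Λ : Type) : Type
  | visit (l : Λ)
  | link (l : Λ)

namespace RunLetter

variable {Λ : Type}

instance [Finite Λ] : Finite (RunLetter Λ) :=
  Finite.of_surjective (Sum.elim visit link) fun s => match s with
    | visit l => ⟨.inl l, rfl⟩
    | link l => ⟨.inr l, rfl⟩

noncomputable instance [Finite Λ] : Fintype (RunLetter Λ) := Fintype.ofFinite _

/-- The letter announces a step. -/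
def IsVisit (s : RunLetter Λ) : Prop := ∃ l, s = visit l

variable (Λ) in
/-- The number of letters. -/
noncomputable def num [Finite Λ] : ℕ := Fintype.card (RunLetter Λ)

/-- The numbering by which letters occur in formulas and data words. -/
noncomputable def equiv [Finite Λ] : RunLetter Λ ≃ Fin (num Λ) := Fintype.equivFin _

end RunLetter

/-- The run letter at a position. -/
noncomputable def DataWord.sym {Λ : Type} [Finite Λ] {D : Type*} (w : DataWord (RunLetter.num Λ) D)
    (i : Fin w.len) : RunLetter Λ := RunLetter.equiv.symm (w.letter i)

namespace Formula

variable {op : DataQuantifier} {Λ : Type} {D : Type*}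

/-- The disjunction of a list of formulas. -/
def disj : List (Formula op) → Formula op
  | [] => and test notTest
  | φ :: l => or φ (disj l)

/-- The conjunction of a list of formulas. -/
def conj : List (Formula op) → Formula op
  | [] => or test notTest
  | φ :: l => and φ (conj l)

section

variable {n : ℕ} {w : DataWord n D} {i : Fin w.len} {d : D} {l : List (Formula op)}

theorem holds_disj : (disj l).Holds w i d ↔ ∃ φ ∈ l, φ.Holds w i d := by
  induction l with
  | nil => simp [disj, Holds]
  | cons φ l ih => simp [disj, Holds, ih]

theorem holds_conj : (conj l).Holds w i d ↔ ∀ φ ∈ l, φ.Holds w i d := by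
  induction l with
  | nil => simp [conj, Holds, em]
  | cons φ l ih => simp [conj, Holds, ih]

theorem overAlphabet_disj : (disj l).OverAlphabet n ↔ ∀ φ ∈ l, φ.OverAlphabet n := by
  induction l with
  | nil => simp [disj, OverAlphabet]
  | cons φ l ih => simp [disj, OverAlphabet, ih]

theorem overAlphabet_conj : (conj l).OverAlphabet n ↔ ∀ φ ∈ l, φ.OverAlphabet n := by
  induction l with
  | nil => simp [conj, OverAlphabet]
  | cons φ l ih => simp [conj, OverAlphabet, ih]

end

section

variable [Finite Λ]

open Classical in
/-- The run letter at the current position satisfies `P`. -/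
noncomputable def sym (P : RunLetter Λ → Prop) : Formula op :=
  disj ((Finset.univ.filter P).toList.map fun s => letter (RunLetter.equiv s))

/-- If the run letter at the current position satisfies `P`, then `φ` holds. -/
noncomputable def imp (P : RunLetter Λ → Prop) (φ : Formula op) : Formula op :=
  or (sym fun s => ¬ P s) φ

/-- Wherever the run letter satisfies `P`, the formula `φ` holds for the current datum. -/
noncomputable def onSym (P : RunLetter Λ → Prop) (φ : Formula op) : Formula op :=
  globally (imp P (freeze φ))

variable {w : DataWord (RunLetter.num Λ) D} {i : Fin w.len} {d : D} {P : RunLetter Λ → Prop}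
  {φ : Formula op}

theorem holds_sym : (sym P : Formula op).Holds w i d ↔ P (w.sym i) := by
  simp only [sym, holds_disj, List.mem_map, Finset.mem_toList, Finset.mem_filter,
    Finset.mem_univ, true_and, exists_exists_and_eq_and, Holds, DataWord.sym]
  constructor
  · rintro ⟨s, hs, h⟩
    rwa [Fin.ext h, Equiv.symm_apply_apply]
  · exact fun h => ⟨_, h, by simp⟩

theorem holds_imp : (imp P φ).Holds w i d ↔ (P (w.sym i) → φ.Holds w i d) := by
  simp only [imp, Holds, holds_sym, imp_iff_not_or]

theorem holds_onSym :
    (onSym P φ).Holds w w.first d ↔ ∀ i, P (w.sym i) → φ.Holds w i (w.datum i) := by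
  simp only [onSym, Holds, holds_imp]
  exact forall_congr' fun i => forall_prop_of_true (Nat.zero_le _)

theorem overAlphabet_sym : (sym P : Formula op).OverAlphabet (RunLetter.num Λ) := by
  simp [sym, overAlphabet_disj, OverAlphabet]

theorem overAlphabet_imp :
    (imp P φ).OverAlphabet (RunLetter.num Λ) ↔ φ.OverAlphabet (RunLetter.num Λ) :=
  and_iff_right overAlphabet_sym

theorem overAlphabet_onSym :
    (onSym P φ).OverAlphabet (RunLetter.num Λ) ↔ φ.OverAlphabet (RunLetter.num Λ) :=
  overAlphabet_imp (φ := freeze φ)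

end

section

variable [Fintype Λ]

/-- The conjunction of a finite family of formulas. -/
noncomputable def all (f : Λ → Formula op) : Formula op := conj (Finset.univ.toList.map f)

theorem holds_all {n : ℕ} {w : DataWord n D} {i : Fin w.len} {d : D} {f : Λ → Formula op} :
    (all f).Holds w i d ↔ ∀ l, (f l).Holds w i d := by
  simp [all, holds_conj]

theorem overAlphabet_all {n : ℕ} {f : Λ → Formula op} :
    (all f).OverAlphabet n ↔ ∀ l, (f l).OverAlphabet n := by
  simp [all, overAlphabet_conj]

end

end Formula

namespace CounterGraph

open Formula RunLetter

variable {Λ : Type} (G : CounterGraph Λ)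

/-- `s` announces a step that decrements a counter. -/
def IsDec (s : RunLetter Λ) : Prop := ∃ l r, s = visit l ∧ G.instr l = some (.dec r)

/-- `s` announces a step that does not decrement a counter, and so has a new datum. -/
def IsNew (s : RunLetter Λ) : Prop := IsVisit s ∧ ¬ G.IsDec s

/-- `s` announces a step that tests the counter incremented at `l`. -/
def Tests (l : Λ) (s : RunLetter Λ) : Prop :=
  ∃ l' r, s = visit l' ∧ G.instr l = some (.inc r) ∧ G.instr l' = some (.zero r)

/-- `s` announces a step that decrements the counter incremented at `l`. -/
def Cancels (l : Λ) (s : RunLetter Λ) : Prop :=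
  ∃ l' r, s = visit l' ∧ G.instr l = some (.inc r) ∧ G.instr l' = some (.dec r)

theorem Cancels.isNew {G : CounterGraph Λ} {l : Λ} {s : RunLetter Λ} (h : G.Cancels l s) :
    G.IsNew (visit l) := by
  refine ⟨⟨l, rfl⟩, ?_⟩
  rintro ⟨_, _, ⟨⟩, hdec⟩
  obtain ⟨_, _, _, hinc, _⟩ := h
  rw [hinc] at hdec
  cases hdec

variable [Fintype Λ] {op : DataQuantifier} {D : Type*}

/-- The register content does not occur later with the letter `link l`. -/
noncomputable def noLinkAhead (l : Λ) : Formula op := globally (imp (· = link l) notTest)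

/-- The current position announces a step at `l` with the register content as datum. -/
noncomputable def here (l : Λ) : Formula op := and (sym (· = visit l)) test

/-- The negation of `CounterGraph.here`. -/
noncomputable def notHere (l : Λ) : Formula op := or (sym (Λ := Λ) (· ≠ visit l)) notTest

/-- The conditions on the data word that only look ahead. An announcement after that of a step
at `l` belongs to the next step if `link l` with the datum of the step at `l` is still to come. -/
noncomputable def core : Formula op := conj [
  all fun l : Λ => onSym (fun s => s = visit l ∧ G.instr l ≠ none)
    (future (and (sym (Λ := Λ) IsVisit) (and (notHere l)
      (future (and (sym (· = link l)) test))))),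
  all fun l : Λ => onSym (· = visit l) (globally (imp (fun s => ∃ l', s = visit l' ∧ ¬ G.next l l')
    (or (here l) (noLinkAhead l)))),
  all fun l : Λ => onSym (· = visit l) (globally (imp (Λ := Λ) IsVisit (or (here l)
    (globally (imp (fun s => ∃ l', s = visit l' ∧ G.instr l' = G.instr l) notTest))))),
  all fun l : Λ => onSym (· = visit l) (or (globally (sym fun s => ¬ G.Tests l s))
    (future (and (sym (G.Cancels l)) test))),
  all fun l : Λ => onSym (· = visit l) (globally (imp (G.Tests l)
    (globally (imp (G.Cancels l) notTest))))]

/-- The meaning of `CounterGraph.core`. -/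
structure Describes (w : DataWord (RunLetter.num Λ) D) : Prop where
  exists_next : ∀ l i, w.sym i = visit l ∧ G.instr l ≠ none → ∃ j, i ≤ j ∧
    IsVisit (w.sym j) ∧ (w.sym j ≠ visit l ∨ w.datum i ≠ w.datum j) ∧
      ∃ k, j ≤ k ∧ w.sym k = link l ∧ w.datum i = w.datum k
  next : ∀ l i, w.sym i = visit l → ∀ j, i ≤ j → (∃ l', w.sym j = visit l' ∧ ¬ G.next l l') →
    (w.sym j = visit l ∧ w.datum i = w.datum j) ∨
      ∀ k, j ≤ k → w.sym k = link l → w.datum i ≠ w.datum k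
  fresh : ∀ l i, w.sym i = visit l → ∀ j, i ≤ j → IsVisit (w.sym j) →
    (w.sym j = visit l ∧ w.datum i = w.datum j) ∨
      ∀ k, j ≤ k → (∃ l', w.sym k = visit l' ∧ G.instr l' = G.instr l) → w.datum i ≠ w.datum k
  cancel_of_test : ∀ l i, w.sym i = visit l → (∀ j, i ≤ j → ¬ G.Tests l (w.sym j)) ∨
    ∃ c, i ≤ c ∧ G.Cancels l (w.sym c) ∧ w.datum i = w.datum c
  cancel_lt_test : ∀ l i, w.sym i = visit l → ∀ j, i ≤ j → G.Tests l (w.sym j) →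
    ∀ c, j ≤ c → G.Cancels l (w.sym c) → w.datum i ≠ w.datum c

/-- Every decrement has the datum of an earlier increment of the same counter. -/
def Backed (w : DataWord (RunLetter.num Λ) D) : Prop :=
  ∀ c, G.IsDec (w.sym c) → ∃ i < c, ∃ l, w.sym i = visit l ∧ G.Cancels l (w.sym c) ∧
    w.datum i = w.datum c

/-- A formula for `CounterGraph.Backed`, which is the only condition that looks back. -/
noncomputable def backward : (op : DataQuantifier) → Formula op
  | .existsPast => and (globally (or (sym G.IsNew) (quant test)))
      (all fun l => onSym (fun s => s = visit l ∧ G.IsNew s)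
        (globally (imp (fun s => G.IsDec s ∧ ¬ G.Cancels l s) notTest)))
  | .forallFuture => and
      (all fun l => quant (or (globally (imp (fun s => s = visit l ∧ G.IsDec s) notTest))
        (future (and (sym fun s => ∃ l', s = visit l' ∧ G.Cancels l' (visit l)) test))))
      (onSym G.IsDec (globally (imp G.IsNew notTest)))

/-- The node `init` is visited `n` times, and then a start node. -/
noncomputable def input : ℕ → Formula op
  | 0 => sym fun s => ∃ l, s = visit l ∧ G.start l
  | n + 1 => and (sym (· = visit G.init)) (freeze (globally (imp (Λ := Λ) IsVisit
      (or (here G.init) (or (noLinkAhead G.init) (input n))))))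

/-- The formula satisfied by the data words that describe halting runs on input `n`. -/
noncomputable def formula (n : ℕ) : Formula op :=
  .and (.and G.core (G.backward op)) (G.input n)

theorem overAlphabet_formula (n : ℕ) :
    (G.formula n : Formula op).OverAlphabet (RunLetter.num Λ) := by
  have hinput : (G.input n : Formula op).OverAlphabet (RunLetter.num Λ) := by
    induction n with
    | zero => exact overAlphabet_sym
    | succ n ih =>
      simp only [input, here, OverAlphabet, overAlphabet_imp, noLinkAhead, ih, overAlphabet_sym,
        and_self]
  refine ⟨⟨?_, ?_⟩, hinput⟩
  · simp [core, conj, overAlphabet_all, overAlphabet_onSym, overAlphabet_imp, overAlphabet_sym,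
      OverAlphabet, here, notHere, noLinkAhead]
  · cases op <;> simp [backward, overAlphabet_all, overAlphabet_onSym, overAlphabet_imp,
      overAlphabet_sym, OverAlphabet]

variable {G} {w : DataWord (RunLetter.num Λ) D} {d : D}

theorem holds_core : (G.core : Formula op).Holds w w.first d ↔ G.Describes w := by
  simp only [core, conj, holds_onSym, holds_all, Holds, holds_sym, holds_imp, here, notHere,
    noLinkAhead]
  exact ⟨fun ⟨h1, h2, h3, h4, h5, _⟩ => ⟨h1, h2, h3, h4, h5⟩,
    fun ⟨h1, h2, h3, h4, h5⟩ => ⟨h1, h2, h3, h4, h5, em _⟩⟩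

theorem holds_input_zero {i : Fin w.len} :
    (G.input 0 : Formula op).Holds w i d ↔ ∃ l, w.sym i = visit l ∧ G.start l := by
  simp only [input, holds_sym]

theorem holds_input_succ {n : ℕ} {i : Fin w.len} :
    (G.input (n + 1) : Formula op).Holds w i d ↔ w.sym i = visit G.init ∧ ∀ j, i ≤ j →
      IsVisit (w.sym j) → (w.sym j = visit G.init ∧ w.datum i = w.datum j) ∨
        (∀ k, j ≤ k → w.sym k = link G.init → w.datum i ≠ w.datum k) ∨
          (G.input n : Formula op).Holds w j (w.datum i) := by
  simp only [input, Holds, holds_sym, holds_imp, here, noLinkAhead]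

theorem backed_of_holds (h : (G.backward op).Holds w w.first d) : G.Backed w := by
  cases op with
  | existsPast =>
    simp only [backward, Holds, holds_all, holds_onSym, holds_imp, holds_sym,
      DataQuantifier.Ranges] at h
    obtain ⟨hfirst, hcancels⟩ := h
    intro c hc
    obtain ⟨i, hi, hmin⟩ := WellFounded.has_min wellFounded_lt {i | w.datum i = w.datum c} ⟨c, rfl⟩
    have hic : i ≤ c := not_lt.1 (hmin c rfl)
    obtain hnew | ⟨j, hji, hj⟩ := hfirst i (Nat.zero_le _)
    · obtain ⟨l, hl⟩ := hnew.1
      have hlt : i < c := hic.lt_of_ne (by rintro rfl; exact hnew.2 hc)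
      refine ⟨i, hlt, l, hl, ?_, hi⟩
      by_contra hn
      exact hcancels l i ⟨hl, hnew⟩ c hic ⟨hc, hn⟩ hi
    · exact absurd hji (hmin j (hj.trans hi))
  | forallFuture =>
    simp only [backward, Holds, holds_all, holds_onSym, holds_imp, holds_sym,
      DataQuantifier.Ranges] at h
    obtain ⟨hinc, hlt⟩ := h
    intro c hc
    obtain ⟨l, _, hl, _⟩ := id hc
    obtain h | ⟨i, -, ⟨l', hl', hcancels⟩, hd⟩ := hinc l c (Nat.zero_le _)
    · exact absurd rfl (h c (Nat.zero_le _) ⟨hl, hc⟩)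
    · refine ⟨i, not_le.1 fun hci => ?_, l', hl', hl ▸ hcancels, hd.symm⟩
      exact hlt c hc i hci (hl' ▸ hcancels.isNew) hd

theorem holds_backward (hB : G.Backed w)
    (hlink : ∀ i, ¬ IsVisit (w.sym i) → ∃ j < i, w.datum i = w.datum j)
    (hinj : ∀ i j, G.IsNew (w.sym i) → G.IsNew (w.sym j) → w.datum i = w.datum j → i = j) :
    (G.backward op).Holds w w.first d := by
  cases op with
  | existsPast =>
    simp only [backward, Holds, holds_all, holds_onSym, holds_imp, holds_sym,
      DataQuantifier.Ranges]
    refine ⟨fun i _ => or_iff_not_imp_left.2 fun hi => ?_, ?_⟩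
    · by_cases hv : IsVisit (w.sym i)
      · obtain ⟨j, hj, -, -, -, hd⟩ := hB i (not_not.1 fun hdec => hi ⟨hv, hdec⟩)
        exact ⟨j, hj, hd⟩
      · obtain ⟨j, hj, hd⟩ := hlink i hv
        exact ⟨j, hj, hd.symm⟩
    rintro l i ⟨hi, hnew⟩ c _ ⟨hc, hn⟩ hd
    obtain ⟨j, hj, l', hl', hcancels, hd'⟩ := hB c hc
    obtain rfl := hinj i j hnew (hl' ▸ hcancels.isNew) (hd.trans hd'.symm)
    rw [hi] at hl'
    cases hl'
    exact hn hcancels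
  | forallFuture =>
    simp only [backward, Holds, holds_all, holds_onSym, holds_imp, holds_sym,
      DataQuantifier.Ranges]
    constructor
    · intro l j _
      rw [or_iff_not_imp_left]
      intro h
      push Not at h
      obtain ⟨c, -, ⟨hl, hc⟩, hd⟩ := h
      obtain ⟨i, -, l', hl', hcancels, hd'⟩ := hB c hc
      exact ⟨i, Nat.zero_le _, ⟨l', hl', hl ▸ hcancels⟩, hd.trans hd'.symm⟩
    · rintro c hc i hci hi hd
      obtain ⟨j, hj, l', hl', hcancels, hd'⟩ := hB c hc
      obtain rfl := hinj i j hi (hl' ▸ hcancels.isNew) (hd.symm.trans hd'.symm)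
      exact absurd hj hci.not_gt

end CounterGraph

/-! ### From data words to halting runs -/

namespace CounterGraph

open Formula RunLetter

variable {Λ : Type} {G : CounterGraph Λ} [Fintype Λ] {D : Type*} {w : DataWord (RunLetter.num Λ) D}

variable (w) in
/-- The step at `l` is announced at position `p` and not before. -/
def Announces (p : Fin w.len) (l : Λ) : Prop :=
  w.sym p = visit l ∧ ∀ q < p, w.sym q = visit l → w.datum q ≠ w.datum p

variable (G w) in
/-- The step at `l'` first announced at `p'` follows the step at `l` first announced at `p`. -/
structure Follows (p : Fin w.len) (l : Λ) (p' : Fin w.len) (l' : Λ) : Prop where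
  left : Announces w p l
  right : Announces w p' l'
  lt : p < p'
  next : G.next l l'
  between : ∀ q m, p ≤ q → q < p' → w.sym q = visit m → m = l ∧ w.datum p = w.datum q
  link : ∃ k, p' ≤ k ∧ w.sym k = link l ∧ w.datum p = w.datum k

theorem Describes.exists_follows (h : G.Describes w) {p : Fin w.len} {l : Λ}
    (hp : Announces w p l) (hl : G.instr l ≠ none) : ∃ p' l', G.Follows w p l p' l' := by
  obtain ⟨u, hpu, hu, hne, k, huk, hk⟩ := h.exists_next l p ⟨hp.1, hl⟩
  obtain ⟨p', ⟨hpp', ⟨l', hl'⟩, hne'⟩, hmin⟩ := WellFounded.has_min wellFounded_lt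
    {q | p ≤ q ∧ IsVisit (w.sym q) ∧ (w.sym q ≠ visit l ∨ w.datum p ≠ w.datum q)}
    ⟨u, hpu, hu, hne⟩
  have hp'k : p' ≤ k := (not_lt.1 (hmin u ⟨hpu, hu, hne⟩)).trans huk
  rw [hl'] at hne'
  have hlt : p < p' := hpp'.lt_of_ne (by rintro rfl; simp_all [hp.1])
  have hbetween (q : Fin w.len) (m : Λ) (hpq : p ≤ q) (hqp' : q < p') (hm : w.sym q = visit m) :
      m = l ∧ w.datum p = w.datum q := by
    have hq := fun hne => hmin q ⟨hpq, ⟨m, hm⟩, hne⟩ hqp'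
    simpa [hm] using hq
  have hnext : G.next l l' := by
    by_contra hn
    obtain ⟨hl, hd⟩ | hk' := h.next l p hp.1 p' hlt.le ⟨l', hl', hn⟩
    · simp_all
    · exact hk' k hp'k hk.1 hk.2
  refine ⟨p', l', hp, ⟨hl', fun q hq hv hd => ?_⟩, hlt, hnext, hbetween, k, hp'k, hk⟩
  obtain hqp | hpq := lt_or_ge q p
  · obtain ⟨hl, hd'⟩ | hfresh := h.fresh l' q hv p hqp.le ⟨l, hp.1⟩
    · rw [hp.1] at hl
      simp_all
    · exact hfresh p' hlt.le ⟨l', hl', rfl⟩ hd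
  · obtain ⟨rfl, hd'⟩ := hbetween q l' hpq hq hv
    simp_all

variable (G w) in
/-- The data of the steps announced before `p` that perform the operation `a`. -/
def dataBefore (a : CounterOp) (p : Fin w.len) : Set D :=
  w.datum '' {q | q < p ∧ ∃ l, w.sym q = visit l ∧ G.instr l = some a}

theorem finite_dataBefore (a : CounterOp) (p : Fin w.len) : (G.dataBefore w a p).Finite :=
  (Set.toFinite _).image _

theorem Describes.datum_notMem_dataBefore (h : G.Describes w) {p : Fin w.len} {l : Λ}
    (hp : Announces w p l) {a : CounterOp} (ha : G.instr l = some a) :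
    w.datum p ∉ G.dataBefore w a p := by
  rintro ⟨q, ⟨hq, m, hm, hma⟩, hd⟩
  obtain ⟨hl, -⟩ | hfresh := h.fresh m q hm p hq.le ⟨l, hp.1⟩
  · obtain rfl : l = m := by simpa [hp.1] using hl
    exact hp.2 q hq hm hd
  · exact hfresh p le_rfl ⟨l, hp.1, ha.trans hma.symm⟩ hd

theorem Backed.datum_mem_dataBefore (hB : G.Backed w) {c : Fin w.len} {l : Λ}
    (hc : w.sym c = visit l) {r : ℕ} (hr : G.instr l = some (.dec r)) :
    w.datum c ∈ G.dataBefore w (.inc r) c := by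
  obtain ⟨i, hic, l', hl', ⟨m, s, hm, hs, hms⟩, hd⟩ := hB c ⟨l, r, hc, hr⟩
  obtain rfl : l = m := by simpa [hc] using hm
  obtain rfl : r = s := by simpa [hr] using hms
  exact ⟨i, ⟨hic, l', hl', hs⟩, hd⟩

theorem dataBefore_mono (a : CounterOp) {p p' : Fin w.len} (h : p ≤ p') :
    G.dataBefore w a p ⊆ G.dataBefore w a p' :=
  Set.image_mono fun _ hq => ⟨hq.1.trans_le h, hq.2⟩

theorem Backed.dataBefore_subset (hB : G.Backed w) (r : ℕ) (p : Fin w.len) :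
    G.dataBefore w (.dec r) p ⊆ G.dataBefore w (.inc r) p := by
  rintro _ ⟨c, ⟨hc, l, hl, hr⟩, rfl⟩
  exact dataBefore_mono _ hc.le (hB.datum_mem_dataBefore hl hr)

theorem Describes.dataBefore_subset (h : G.Describes w) {p : Fin w.len} {l : Λ}
    (hp : w.sym p = visit l) {r : ℕ} (hr : G.instr l = some (.zero r)) :
    G.dataBefore w (.inc r) p ⊆ G.dataBefore w (.dec r) p := by
  rintro _ ⟨q, ⟨hq, m, hm, hmr⟩, rfl⟩
  have htest : G.Tests m (w.sym p) := ⟨l, r, hp, hmr, hr⟩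
  obtain hn | ⟨c, -, hcancels, hd⟩ := h.cancel_of_test m q hm
  · exact absurd htest (hn p hq.le)
  · have hcp : c < p := not_le.1 fun hpc => h.cancel_lt_test m q hm p hq.le htest c hpc hcancels hd
    obtain ⟨l', s, hl', hs, hdec⟩ := hcancels
    obtain rfl : r = s := by simpa [hmr] using hs
    exact ⟨c, ⟨hcp, l', hl', hdec⟩, hd.symm⟩

namespace Follows

variable {p p' : Fin w.len} {l l' : Λ}

theorem dataBefore_eq_insert (hF : G.Follows w p l p' l') {a : CounterOp}
    (ha : G.instr l = some a) :
    G.dataBefore w a p' = insert (w.datum p) (G.dataBefore w a p) := by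
  apply subset_antisymm
  · rintro _ ⟨q, ⟨hq, m, hm, hma⟩, rfl⟩
    obtain hqp | hpq := lt_or_ge q p
    · exact .inr ⟨q, ⟨hqp, m, hm, hma⟩, rfl⟩
    · exact .inl (hF.between q m hpq hq hm).2.symm
  · exact Set.insert_subset ⟨p, ⟨hF.lt, l, hF.left.1, ha⟩, rfl⟩ (dataBefore_mono a hF.lt.le)

theorem dataBefore_eq (hF : G.Follows w p l p' l') {a : CounterOp} (ha : G.instr l ≠ some a) :
    G.dataBefore w a p' = G.dataBefore w a p := by
  refine subset_antisymm ?_ (dataBefore_mono a hF.lt.le)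
  rintro _ ⟨q, ⟨hq, m, hm, hma⟩, rfl⟩
  obtain hqp | hpq := lt_or_ge q p
  · exact ⟨q, ⟨hqp, m, hm, hma⟩, rfl⟩
  · obtain ⟨rfl, -⟩ := hF.between q m hpq hq hm
    exact absurd hma ha

theorem ncard_dataBefore (hF : G.Follows w p l p' l') (h : G.Describes w) (a : CounterOp)
    [Decidable (G.instr l = some a)] :
    (G.dataBefore w a p').ncard =
      (G.dataBefore w a p).ncard + if G.instr l = some a then 1 else 0 := by
  split_ifs with ha
  · rw [hF.dataBefore_eq_insert ha, Set.ncard_insert_of_notMem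
      (h.datum_notMem_dataBefore hF.left ha) (finite_dataBefore _ _)]
  · rw [hF.dataBefore_eq ha, add_zero]

end Follows

/-- The contents of the counters before the step announced at `p`: the number of increments
minus the number of decrements. -/
noncomputable def countersAt (G : CounterGraph Λ) (w : DataWord (RunLetter.num Λ) D)
    (p : Fin w.len) : Counters :=
  fun r => (G.dataBefore w (.inc r) p).ncard - (G.dataBefore w (.dec r) p).ncard

open Classical in
theorem Follows.step {p p' : Fin w.len} {l l' : Λ} (hF : G.Follows w p l p' l')
    (h : G.Describes w) (hB : G.Backed w) {a : CounterOp} (ha : G.instr l = some a) :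
    a.Step (G.countersAt w p) (G.countersAt w p') := by
  have hle (r : ℕ) (p) :
      (G.dataBefore w (.dec r) p).ncard ≤ (G.dataBefore w (.inc r) p).ncard :=
    Set.ncard_le_ncard (hB.dataBefore_subset r p) (finite_dataBefore _ _)
  have hinc (r : ℕ) := hF.ncard_dataBefore h (.inc r)
  have hdec (r : ℕ) := hF.ncard_dataBefore h (.dec r)
  simp only [ha, Option.some.injEq] at hinc hdec
  cases a with
  | inc r =>
    funext s
    have := hle s p
    simp only [CounterOp.inc.injEq, reduceCtorEq, if_false] at hinc hdec
    simp only [countersAt, Function.update_apply, hinc, hdec]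
    grind
  | dec r =>
    have hlt : (G.dataBefore w (.dec r) p).ncard < (G.dataBefore w (.inc r) p).ncard :=
      Set.ncard_lt_ncard (Set.ssubset_iff_subset_ne.2 ⟨hB.dataBefore_subset r p, fun heq =>
        h.datum_notMem_dataBefore hF.left ha (heq ▸ hB.datum_mem_dataBefore hF.left.1 ha)⟩)
        (finite_dataBefore _ _)
    refine ⟨(Nat.sub_pos_of_lt hlt).ne', ?_⟩
    funext s
    simp only [CounterOp.dec.injEq, reduceCtorEq, if_false] at hinc hdec
    simp only [countersAt, Function.update_apply, hinc, hdec]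
    grind
  | zero r =>
    have heq := (h.dataBefore_subset hF.left.1 ha).antisymm (hB.dataBefore_subset r p)
    refine ⟨by simp [countersAt, heq], ?_⟩
    funext s
    simp [countersAt, hinc, hdec]

theorem Describes.haltsFrom (h : G.Describes w) (hB : G.Backed w) {p : Fin w.len} {l : Λ}
    (hp : Announces w p l) : G.HaltsFrom l (G.countersAt w p) := by
  induction p using WellFoundedGT.induction generalizing l with
  | ind p ih =>
    cases ha : G.instr l with
    | none => exact .halt ha
    | some a =>
      obtain ⟨p', l', hF⟩ := h.exists_follows hp (by simp [ha])
      exact .step ha (hF.step h hB ha) hF.next (ih p' hF.lt hF.right)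

theorem Describes.exists_haltsFrom_of_input (h : G.Describes w) (hB : G.Backed w)
    {op : DataQuantifier} {n : ℕ} {p : Fin w.len} {l : Λ} (hp : Announces w p l) {d : D}
    (hn : (G.input n : Formula op).Holds w p d) :
    ∃ l, G.start l ∧
      G.HaltsFrom l (update (G.countersAt w p) 0 (G.countersAt w p 0 + n)) := by
  induction n generalizing p l d with
  | zero =>
    obtain ⟨l', hl', hs⟩ := holds_input_zero.1 hn
    obtain rfl : l = l' := by simpa [hp.1] using hl'
    exact ⟨l, hs, by simpa using h.haltsFrom hB hp⟩
  | succ n ih =>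
    obtain ⟨hinit, hahead⟩ := holds_input_succ.1 hn
    obtain rfl : l = G.init := by simpa [hp.1] using hinit
    obtain ⟨p', l', hF⟩ := h.exists_follows hp (by simp [G.instr_init])
    obtain ⟨k, hk, hlink, hd⟩ := hF.link
    have hn' : (G.input n : Formula op).Holds w p' (w.datum p) := by
      obtain ⟨hl, hd'⟩ | hk' | hn' := hahead p' hF.lt.le ⟨l', hF.right.1⟩
      · obtain rfl : l' = G.init := by simpa [hF.right.1] using hl
        exact absurd hd' (hF.right.2 p hF.lt hinit)
      · exact absurd hd (hk' k hk hlink)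
      · exact hn'
    obtain ⟨m, hm, hm'⟩ := ih hF.right hn'
    have hstep : G.countersAt w p' = _ := hF.step h hB G.instr_init
    refine ⟨m, hm, ?_⟩
    simpa [hstep, add_assoc, add_comm 1] using hm'

theorem halts_of_satisfiable {op : DataQuantifier} {n : ℕ}
    (hs : (G.formula n : Formula op).Satisfiable D (RunLetter.num Λ)) : G.Halts n := by
  obtain ⟨w, ⟨hcore, hback⟩, hn⟩ := hs
  have hfirst (q : Fin w.len) : ¬ q < w.first := Nat.not_lt_zero _
  obtain ⟨l, hl⟩ : ∃ l, w.sym w.first = visit l := by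
    cases n with
    | zero => exact (holds_input_zero.1 hn).imp fun _ => And.left
    | succ n => exact ⟨_, (holds_input_succ.1 hn).1⟩
  have hhalts := (holds_core.1 hcore).exists_haltsFrom_of_input (backed_of_holds hback)
    ⟨hl, fun q hq => absurd hq (hfirst q)⟩ hn
  have hzero : G.countersAt w w.first = 0 := by
    funext r
    simp [countersAt, dataBefore, hfirst]
  simpa [hzero, Halts] using hhalts

end CounterGraph

/-! ### From halting runs to data words -/

namespace CounterGraph

open Formula RunLetter

section

variable {Λ : Type} {G : CounterGraph Λ}

/-- A halting run that visits the nodes `s 0, …, s N` with counters `u 0, …, u N`. -/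
structure IsRun (G : CounterGraph Λ) (N : ℕ) (s : ℕ → Λ) (u : ℕ → Counters) : Prop where
  step : ∀ i < N, ∃ a, G.instr (s i) = some a ∧ a.Step (u i) (u (i + 1)) ∧ G.next (s i) (s (i + 1))
  halt : G.instr (s N) = none

theorem IsRun.cons {N : ℕ} {s : ℕ → Λ} {u : ℕ → Counters} (h : G.IsRun N s u) {l : Λ}
    {v : Counters} {a : CounterOp} (ha : G.instr l = some a) (hv : a.Step v (u 0))
    (hn : G.next l (s 0)) :
    G.IsRun (N + 1) (fun i => i.casesOn l s) (fun i => i.casesOn v u) where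
  step i hi := by
    cases i with
    | zero => exact ⟨a, ha, hv, hn⟩
    | succ i => exact h.step i (Nat.lt_of_succ_lt_succ hi)
  halt := h.halt

theorem HaltsFrom.exists_isRun {l : Λ} {v : Counters} (h : G.HaltsFrom l v) :
    ∃ N s u, G.IsRun N s u ∧ s 0 = l ∧ u 0 = v := by
  induction h with
  | @halt l v h => exact ⟨0, fun _ => l, fun _ => v, ⟨by simp, h⟩, rfl, rfl⟩
  | step ha hv hn _ ih =>
    obtain ⟨N, s, u, h, rfl, rfl⟩ := ih
    exact ⟨_, _, _, h.cons ha hv hn, rfl, rfl⟩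

theorem HaltsFrom.exists_isRun_of_input {l : Λ} (hl : G.start l) {n : ℕ} {v : Counters}
    (h : G.HaltsFrom l (update v 0 (v 0 + n))) :
    ∃ N s u, G.IsRun N s u ∧ u 0 = v ∧ (∀ i < n, s i = G.init) ∧ G.start (s n) := by
  induction n generalizing v with
  | zero =>
    obtain ⟨N, s, u, hr, rfl, hu⟩ := h.exists_isRun
    exact ⟨N, s, u, hr, by simpa using hu, by simp, hl⟩
  | succ n ih =>
    obtain ⟨N, s, u, h, hu, hinit, hs⟩ := ih (v := update v 0 (v 0 + 1))
      (by simpa [add_assoc, add_comm 1] using h)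
    refine ⟨_, _, _, h.cons G.instr_init hu (G.next_init _), rfl, fun i hi => ?_, hs⟩
    cases i with
    | zero => rfl
    | succ i => exact hinit i (Nat.lt_of_succ_lt_succ hi)

open Classical in
/-- The step whose increment is cancelled by the decrement in the `i`-th step; the `i`-th step
itself if it does not decrement a counter. The `k`-th decrement of a counter cancels the `k`-th
increment. -/
noncomputable def token (G : CounterGraph Λ) (s : ℕ → Λ) (i : ℕ) : ℕ :=
  match G.instr (s i) with
  | some (.dec r) => Nat.nth (fun j => G.instr (s j) = some (.inc r))
      (Nat.count (fun j => G.instr (s j) = some (.dec r)) i)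
  | _ => i

theorem token_of_not_dec {s : ℕ → Λ} {i : ℕ} (h : ∀ r, G.instr (s i) ≠ some (.dec r)) :
    G.token s i = i := by
  rw [token]
  split
  · exact absurd ‹_› (h _)
  · rfl

open Classical in
theorem token_of_dec {s : ℕ → Λ} {i r : ℕ} (h : G.instr (s i) = some (.dec r)) :
    G.token s i = Nat.nth (fun j => G.instr (s j) = some (.inc r))
      (Nat.count (fun j => G.instr (s j) = some (.dec r)) i) := by
  rw [token, h]

namespace IsRun

variable {N : ℕ} {s : ℕ → Λ} {u : ℕ → Counters}

theorem lt_of_instr (h : G.IsRun N s u) {i : ℕ} (hi : i ≤ N) (hs : G.instr (s i) ≠ none) :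
    i < N := by
  refine hi.lt_of_ne ?_
  rintro rfl
  exact hs h.halt

theorem step_of_instr (h : G.IsRun N s u) {i : ℕ} (hi : i ≤ N) {a : CounterOp}
    (ha : G.instr (s i) = some a) : a.Step (u i) (u (i + 1)) := by
  obtain ⟨b, hb, hstep, -⟩ := h.step i (h.lt_of_instr hi (by simp [ha]))
  obtain rfl : a = b := by simpa [ha] using hb
  exact hstep

open Classical in
theorem counters_add_count (h : G.IsRun N s u) (h0 : u 0 = 0) {i : ℕ} (hi : i ≤ N) (r : ℕ) :
    u i r + Nat.count (fun j => G.instr (s j) = some (.dec r)) i =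
      Nat.count (fun j => G.instr (s j) = some (.inc r)) i := by
  induction i with
  | zero => simp [h0]
  | succ i ih =>
    have ih := ih (Nat.le_of_succ_le hi)
    obtain ⟨a, ha, hstep, -⟩ := h.step i hi
    rw [Nat.count_succ, Nat.count_succ, ha]
    cases a with
    | inc q =>
      rw [show u (i + 1) = _ from hstep, Function.update_apply]
      grind
    | dec q =>
      rw [hstep.2, Function.update_apply]
      grind [hstep.1]
    | zero q =>
      rw [hstep.2]
      simpa using ih

open Classical in
theorem count_lt_count (h : G.IsRun N s u) (h0 : u 0 = 0) {i r : ℕ} (hi : i ≤ N)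
    (hr : G.instr (s i) = some (.dec r)) :
    Nat.count (fun j => G.instr (s j) = some (.dec r)) i <
      Nat.count (fun j => G.instr (s j) = some (.inc r)) i := by
  have hadd := h.counters_add_count h0 hi r
  have hpos := (h.step_of_instr hi hr).1
  omega

theorem token_lt (h : G.IsRun N s u) (h0 : u 0 = 0) {i r : ℕ} (hi : i ≤ N)
    (hr : G.instr (s i) = some (.dec r)) : G.token s i < i := by
  classical
  rw [token_of_dec hr]
  exact Nat.nth_lt_of_lt_count (h.count_lt_count h0 hi hr)

theorem instr_token (h : G.IsRun N s u) (h0 : u 0 = 0) {i r : ℕ} (hi : i ≤ N)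
    (hr : G.instr (s i) = some (.dec r)) : G.instr (s (G.token s i)) = some (.inc r) := by
  classical
  rw [token_of_dec hr]
  exact Nat.nth_mem (p := fun j => G.instr (s j) = some (.inc r)) _ fun hf =>
    (h.count_lt_count h0 hi hr).trans_le (Nat.count_le_card hf i)

theorem token_inj (h : G.IsRun N s u) (h0 : u 0 = 0) {i j : ℕ} (hi : i ≤ N) (hj : j ≤ N)
    (hij : G.instr (s i) = G.instr (s j)) (he : G.token s i = G.token s j) : i = j := by
  classical
  by_cases hdec : ∃ r, G.instr (s i) = some (.dec r)
  · obtain ⟨r, hr⟩ := hdec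
    have hr' := hij.symm.trans hr
    have hlt := h.count_lt_count h0 hi hr
    have hlt' := h.count_lt_count h0 hj hr'
    rw [token_of_dec hr, token_of_dec hr'] at he
    have hcount := congrArg (Nat.count fun j => G.instr (s j) = some (.inc r)) he
    rw [Nat.count_nth fun hf => hlt.trans_le (Nat.count_le_card hf i),
      Nat.count_nth fun hf => hlt'.trans_le (Nat.count_le_card hf j)] at hcount
    exact Nat.count_injective hr hr' hcount
  · push Not at hdec
    rwa [token_of_not_dec hdec, token_of_not_dec (hij ▸ hdec)] at he

theorem exists_token_eq (h : G.IsRun N s u) (h0 : u 0 = 0) {i j r : ℕ} (hi : i ≤ N) (hji : j < i)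
    (hz : G.instr (s i) = some (.zero r)) (hj : G.instr (s j) = some (.inc r)) :
    ∃ k < i, G.instr (s k) = some (.dec r) ∧ G.token s k = j := by
  classical
  have hadd := h.counters_add_count h0 hi r
  rw [(h.step_of_instr hi hz).1, zero_add] at hadd
  have hlt : Nat.count (fun j => G.instr (s j) = some (.inc r)) j <
      Nat.count (fun j => G.instr (s j) = some (.dec r)) i :=
    hadd ▸ Nat.count_strict_mono hj hji
  have hcard (hf : (Set.ofPred fun j => G.instr (s j) = some (.dec r)).Finite) :
      Nat.count (fun j => G.instr (s j) = some (.inc r)) j < hf.toFinset.card :=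
    hlt.trans_le (Nat.count_le_card hf i)
  have hdec := Nat.nth_mem (p := fun j => G.instr (s j) = some (.dec r)) _ hcard
  refine ⟨_, Nat.nth_lt_of_lt_count hlt, hdec, ?_⟩
  rw [token_of_dec hdec, Nat.count_nth hcard]
  exact Nat.nth_count (p := fun j => G.instr (s j) = some (.inc r)) hj

end IsRun

end

variable {Λ : Type} {G : CounterGraph Λ} [Fintype Λ] {D : Type*}

/-- The data word describing a run that visits the nodes `s 0, …, s N`. The `i`-th step is
announced at position `2 * i` and linked at position `2 * i + 3`. At position `1` the subtraction
truncates, which gives the initial step a second link. -/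
noncomputable def runWord (G : CounterGraph Λ) (e : ℕ ↪ D) (N : ℕ) (s : ℕ → Λ) :
    DataWord (RunLetter.num Λ) D where
  len := 2 * (N + 1)
  len_pos := Nat.succ_pos _
  letter p := RunLetter.equiv
    (if (p : ℕ) % 2 = 0 then visit (s (p / 2)) else link (s (p / 2 - 1)))
  datum p := e (G.token s (p / 2 - p % 2))

/-- The position at which the `i`-th step is announced. -/
def visitPos {e : ℕ ↪ D} {N : ℕ} {s : ℕ → Λ} (i : ℕ) (hi : i ≤ N) :
    Fin (G.runWord e N s).len :=
  ⟨2 * i, show _ < 2 * (N + 1) by omega⟩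

section

variable {e : ℕ ↪ D} {N : ℕ} {s : ℕ → Λ} {p : Fin (G.runWord e N s).len} {l : Λ}

theorem sym_runWord : (G.runWord e N s).sym p =
    if (p : ℕ) % 2 = 0 then visit (s (p / 2)) else link (s (p / 2 - 1)) :=
  RunLetter.equiv.symm_apply_apply _

theorem sym_visitPos (i : ℕ) (hi : i ≤ N) :
    (G.runWord e N s).sym (visitPos i hi) = visit (s i) := by
  simp [sym_runWord, visitPos]

theorem datum_visitPos (i : ℕ) (hi : i ≤ N) :
    (G.runWord e N s).datum (visitPos i hi) = e (G.token s i) := by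
  simp [runWord, visitPos]

theorem exists_eq_visitPos (hp : (G.runWord e N s).sym p = visit l) :
    ∃ i, ∃ hi : i ≤ N, s i = l ∧ p = visitPos i hi := by
  have hlen : (p : ℕ) < 2 * (N + 1) := p.2
  rw [sym_runWord] at hp
  split_ifs at hp with h
  cases hp
  exact ⟨p / 2, by omega, rfl, Fin.ext (show (p : ℕ) = 2 * (p / 2) by omega)⟩

theorem exists_of_link (hp : (G.runWord e N s).sym p = link l) :
    ∃ i ≤ N, s i = l ∧ 2 * i < p ∧ p ≤ 2 * i + 3 ∧
      (G.runWord e N s).datum p = e (G.token s i) := by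
  have hlen : (p : ℕ) < 2 * (N + 1) := p.2
  rw [sym_runWord] at hp
  split_ifs at hp with h
  cases hp
  exact ⟨p / 2 - 1, by omega, rfl, by omega, by omega, by simp [runWord, Nat.mod_two_ne_zero.1 h]⟩

theorem exists_link (i : ℕ) (hi : i + 1 ≤ N) : ∃ k, visitPos (i + 1) hi ≤ k ∧
    (G.runWord e N s).sym k = link (s i) ∧ (G.runWord e N s).datum k = e (G.token s i) := by
  refine ⟨⟨2 * i + 3, show _ < 2 * (N + 1) by omega⟩, show 2 * (i + 1) ≤ 2 * i + 3 by omega, ?_, ?_⟩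
  · rw [sym_runWord, if_neg (by simp only; omega), show (2 * i + 3) / 2 - 1 = i by omega]
  · simp only [runWord, show (2 * i + 3) / 2 - (2 * i + 3) % 2 = i by omega]

theorem visitPos_le_visitPos {i j : ℕ} {hi : i ≤ N} {hj : j ≤ N} :
    (visitPos i hi : Fin (G.runWord e N s).len) ≤ visitPos j hj ↔ i ≤ j :=
  Nat.mul_le_mul_left_iff two_pos

theorem visitPos_lt_visitPos {i j : ℕ} {hi : i ≤ N} {hj : j ≤ N} :
    (visitPos i hi : Fin (G.runWord e N s).len) < visitPos j hj ↔ i < j :=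
  Nat.mul_lt_mul_left two_pos

end

namespace IsRun

variable {e : ℕ ↪ D} {N : ℕ} {s : ℕ → Λ} {u : ℕ → Counters}

theorem eq_of_datum_eq (h : G.IsRun N s u) (h0 : u 0 = 0) {i j : ℕ} {hi : i ≤ N} {hj : j ≤ N}
    (hij : G.instr (s i) = G.instr (s j)) (hd : (G.runWord e N s).datum (visitPos i hi) =
      (G.runWord e N s).datum (visitPos j hj)) : i = j := by
  rw [datum_visitPos, datum_visitPos] at hd
  exact h.token_inj h0 hi hj hij (e.injective hd)

theorem exists_cancels_of_tests (h : G.IsRun N s u) (h0 : u 0 = 0) {i : ℕ} {hi : i ≤ N}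
    {q : Fin (G.runWord e N s).len} (hq : visitPos i hi ≤ q)
    (ht : G.Tests (s i) ((G.runWord e N s).sym q)) :
    ∃ c < q, visitPos i hi ≤ c ∧ G.Cancels (s i) ((G.runWord e N s).sym c) ∧
      (G.runWord e N s).datum (visitPos i hi) = (G.runWord e N s).datum c := by
  obtain ⟨l', r, hl', hinc, hzero⟩ := ht
  obtain ⟨j, hj, rfl, rfl⟩ := exists_eq_visitPos hl'
  have hij : i < j :=
    (visitPos_le_visitPos.1 hq).lt_of_ne (by rintro rfl; simp [hinc] at hzero)
  obtain ⟨k, hkj, hdec, rfl⟩ := h.exists_token_eq h0 hj hij hzero hinc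
  have hk := hkj.le.trans hj
  refine ⟨visitPos k hk, visitPos_lt_visitPos.2 hkj,
    visitPos_le_visitPos.2 (h.token_lt h0 hk hdec).le, ⟨_, r, sym_visitPos _ _, hinc, hdec⟩, ?_⟩
  rw [datum_visitPos, datum_visitPos, token_of_not_dec (by simp [hinc])]

theorem eq_of_cancels (h : G.IsRun N s u) (h0 : u 0 = 0) {l : Λ}
    {c c' : Fin (G.runWord e N s).len} (hc : G.Cancels l ((G.runWord e N s).sym c))
    (hc' : G.Cancels l ((G.runWord e N s).sym c'))
    (hd : (G.runWord e N s).datum c = (G.runWord e N s).datum c') : c = c' := by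
  obtain ⟨l₁, r, hl₁, hinc, hdec⟩ := hc
  obtain ⟨l₂, r', hl₂, hinc', hdec'⟩ := hc'
  obtain ⟨i, hi, rfl, rfl⟩ := exists_eq_visitPos hl₁
  obtain ⟨j, hj, rfl, rfl⟩ := exists_eq_visitPos hl₂
  obtain rfl : r = r' := by simpa [hinc] using hinc'
  obtain rfl := h.eq_of_datum_eq h0 (hdec.trans hdec'.symm) hd
  rfl

theorem exists_next_runWord (h : G.IsRun N s u) (h0 : u 0 = 0) {i : ℕ} (hi : i ≤ N)
    (hs : G.instr (s i) ≠ none) :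
    ∃ j : Fin (G.runWord e N s).len, visitPos i hi ≤ j ∧ IsVisit ((G.runWord e N s).sym j) ∧
      ((G.runWord e N s).sym j ≠ visit (s i) ∨
        (G.runWord e N s).datum (visitPos i hi) ≠ (G.runWord e N s).datum j) ∧
      ∃ k, j ≤ k ∧ (G.runWord e N s).sym k = link (s i) ∧
        (G.runWord e N s).datum (visitPos i hi) = (G.runWord e N s).datum k := by
  have hi' := h.lt_of_instr hi hs
  obtain ⟨k, hk, hlink, hd⟩ := exists_link (G := G) (e := e) (s := s) i hi'
  refine ⟨visitPos (i + 1) hi', visitPos_le_visitPos.2 i.le_succ, ⟨_, sym_visitPos _ _⟩, ?_, k,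
    hk, hlink, (datum_visitPos i hi).trans hd.symm⟩
  rw [← not_and_or, sym_visitPos]
  rintro ⟨hl, hd⟩
  exact i.succ_ne_self (h.eq_of_datum_eq h0 (congrArg G.instr (visit.inj hl)) hd.symm)

theorem le_succ_of_link (h : G.IsRun N s u) (h0 : u 0 = 0) {i j : ℕ} {hi : i ≤ N} {hj : j ≤ N}
    {k : Fin (G.runWord e N s).len} (hjk : visitPos j hj ≤ k)
    (hk : (G.runWord e N s).sym k = link (s i))
    (hd : (G.runWord e N s).datum (visitPos i hi) = (G.runWord e N s).datum k) : j ≤ i + 1 := by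
  obtain ⟨m, hm, hl, -, hkm, hd'⟩ := exists_of_link hk
  rw [hd', datum_visitPos] at hd
  obtain rfl := h.token_inj h0 hi hm (congrArg G.instr hl.symm) (e.injective hd)
  have : 2 * j ≤ k := hjk
  omega

theorem describes (h : G.IsRun N s u) (h0 : u 0 = 0) : G.Describes (G.runWord e N s) where
  exists_next := by
    rintro l p ⟨hp, hl⟩
    obtain ⟨i, hi, rfl, rfl⟩ := exists_eq_visitPos hp
    exact h.exists_next_runWord h0 hi hl
  next := by
    rintro l p hp q hpq ⟨l', hq, hn⟩
    obtain ⟨i, hi, rfl, rfl⟩ := exists_eq_visitPos hp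
    obtain ⟨j, hj, rfl, rfl⟩ := exists_eq_visitPos hq
    refine or_iff_not_imp_right.2 fun hlink => ?_
    push Not at hlink
    obtain ⟨k, hjk, hk, hd⟩ := hlink
    obtain hij | rfl := Nat.le_succ_iff.1 (h.le_succ_of_link h0 hjk hk hd)
    · obtain rfl := hij.antisymm (visitPos_le_visitPos.1 hpq)
      exact ⟨hp, rfl⟩
    · obtain ⟨-, -, -, hnext⟩ := h.step i hj
      exact absurd hnext hn
  fresh := by
    rintro l p hp q hpq ⟨l', hq⟩
    obtain ⟨i, hi, rfl, rfl⟩ := exists_eq_visitPos hp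
    obtain ⟨j, hj, rfl, rfl⟩ := exists_eq_visitPos hq
    obtain rfl | hij := (visitPos_le_visitPos.1 hpq).eq_or_lt
    · exact .inl ⟨hq, rfl⟩
    refine .inr ?_
    rintro k hjk ⟨m, hk, hm⟩ hd
    obtain ⟨k, hkN, rfl, rfl⟩ := exists_eq_visitPos hk
    obtain rfl := h.eq_of_datum_eq h0 hm.symm hd
    exact hij.not_ge (visitPos_le_visitPos.1 hjk)
  cancel_of_test := by
    intro l p hp
    obtain ⟨i, hi, rfl, rfl⟩ := exists_eq_visitPos hp
    refine or_iff_not_imp_left.2 fun htests => ?_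
    push Not at htests
    obtain ⟨q, hpq, ht⟩ := htests
    obtain ⟨c, -, hic, hc⟩ := h.exists_cancels_of_tests h0 hpq ht
    exact ⟨c, hic, hc⟩
  cancel_lt_test := by
    intro l p hp q hpq ht c hqc hc hd
    obtain ⟨i, hi, rfl, rfl⟩ := exists_eq_visitPos hp
    obtain ⟨c', hc'q, -, hc', hd'⟩ := h.exists_cancels_of_tests h0 hpq ht
    obtain rfl := h.eq_of_cancels h0 hc hc' (hd.symm.trans hd')
    exact hc'q.not_ge hqc

theorem backed (h : G.IsRun N s u) (h0 : u 0 = 0) : G.Backed (G.runWord e N s) := by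
  rintro c ⟨l, r, hc, hr⟩
  obtain ⟨i, hi, rfl, rfl⟩ := exists_eq_visitPos hc
  have hlt := h.token_lt h0 hi hr
  have hinc := h.instr_token h0 hi hr
  refine ⟨visitPos (G.token s i) (hlt.le.trans hi), visitPos_lt_visitPos.2 hlt, _,
    sym_visitPos _ _, ⟨_, r, hc, hinc, hr⟩, ?_⟩
  rw [datum_visitPos, datum_visitPos, token_of_not_dec (by simp [hinc])]

end IsRun

theorem exists_datum_eq_of_not_isVisit {e : ℕ ↪ D} {N : ℕ} {s : ℕ → Λ}
    {p : Fin (G.runWord e N s).len} (hp : ¬ IsVisit ((G.runWord e N s).sym p)) :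
    ∃ q < p, (G.runWord e N s).datum p = (G.runWord e N s).datum q := by
  obtain ⟨l, hl⟩ : ∃ l, (G.runWord e N s).sym p = link l := by
    cases hs : (G.runWord e N s).sym p with
    | visit l => exact absurd ⟨l, hs⟩ hp
    | link l => exact ⟨l, rfl⟩
  obtain ⟨i, hi, -, hlt, -, hd⟩ := exists_of_link hl
  exact ⟨visitPos i hi, hlt, by rw [hd, datum_visitPos]⟩

theorem eq_of_isNew {e : ℕ ↪ D} {N : ℕ} {s : ℕ → Λ} {p q : Fin (G.runWord e N s).len}
    (hp : G.IsNew ((G.runWord e N s).sym p)) (hq : G.IsNew ((G.runWord e N s).sym q))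
    (hd : (G.runWord e N s).datum p = (G.runWord e N s).datum q) : p = q := by
  have exists_datum {p : Fin (G.runWord e N s).len} (hp : G.IsNew ((G.runWord e N s).sym p)) :
      ∃ i, ∃ hi : i ≤ N, p = visitPos i hi ∧ (G.runWord e N s).datum p = e i := by
    obtain ⟨⟨l, hl⟩, hdec⟩ := hp
    obtain ⟨i, hi, rfl, rfl⟩ := exists_eq_visitPos hl
    refine ⟨i, hi, rfl, ?_⟩
    rw [datum_visitPos, token_of_not_dec fun r hr => hdec ⟨_, r, hl, hr⟩]
  obtain ⟨i, hi, rfl, hpi⟩ := exists_datum hp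
  obtain ⟨j, hj, rfl, hqj⟩ := exists_datum hq
  obtain rfl := e.injective (hpi.symm.trans (hd.trans hqj))
  rfl

theorem IsRun.holds_input {op : DataQuantifier} {e : ℕ ↪ D} {N : ℕ} {s : ℕ → Λ}
    {u : ℕ → Counters} (h : G.IsRun N s u) (h0 : u 0 = 0) {n i : ℕ} (hi : i ≤ N)
    (hinit : ∀ j < n, s (i + j) = G.init) (hs : G.start (s (i + n))) {d : D} :
    (G.input n : Formula op).Holds (G.runWord e N s) (visitPos i hi) d := by
  induction n generalizing i d with
  | zero => exact holds_input_zero.2 ⟨_, sym_visitPos _ _, hs⟩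
  | succ n ih =>
    obtain rfl | _ := hi.eq_or_lt
    · exact absurd (hinit 0 n.succ_pos ▸ h.halt) (by simp [G.instr_init])
    have hsi : s i = G.init := hinit 0 n.succ_pos
    refine holds_input_succ.2 ⟨hsi ▸ sym_visitPos _ _, fun q hiq ⟨l, hl⟩ => ?_⟩
    obtain ⟨j, hj, rfl, rfl⟩ := exists_eq_visitPos hl
    obtain rfl | hij := (visitPos_le_visitPos.1 hiq).eq_or_lt
    · exact .inl ⟨hsi ▸ hl, rfl⟩
    refine .inr (or_iff_not_imp_left.2 fun hlink => ?_)
    push Not at hlink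
    obtain ⟨k, hjk, hk, hd⟩ := hlink
    obtain rfl := (h.le_succ_of_link h0 hjk (hsi ▸ hk) hd).antisymm hij
    exact ih hj (fun j hj => by rw [add_right_comm]; exact hinit (j + 1) (by omega))
      (by rwa [add_right_comm])

theorem satisfiable_of_halts [Infinite D] {op : DataQuantifier} {n : ℕ} (hn : G.Halts n) :
    (G.formula n : Formula op).Satisfiable D (RunLetter.num Λ) := by
  obtain ⟨l, hl, hhalts⟩ := hn
  obtain ⟨N, s, u, h, h0, hinit, hs⟩ :=
    HaltsFrom.exists_isRun_of_input hl (n := n) (v := 0) (by simpa using hhalts)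
  refine ⟨G.runWord (Infinite.natEmbedding D) N s, ⟨holds_core.2 (h.describes h0), ?_⟩, ?_⟩
  · exact holds_backward (h.backed h0) (fun _ => exists_datum_eq_of_not_isVisit)
      fun _ _ => eq_of_isNew
  · exact h.holds_input h0 N.zero_le (by simpa using hinit) (by simpa using hs)

/-! ### The reduction -/

theorem satProblem_formula_iff [Infinite D] {op : DataQuantifier} {n : ℕ} :
    SatProblem D op (RunLetter.num Λ, G.formula n) ↔ G.Halts n :=
  ⟨fun h => halts_of_satisfiable h.2, fun h => ⟨G.overAlphabet_formula n, satisfiable_of_halts h⟩⟩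

end CounterGraph

namespace Formula

variable {op : DataQuantifier}

theorem primrec_eight_mul_add {α : Type*} [Primcodable α] {f : α → ℕ} (hf : Primrec f) (k : ℕ) :
    Primrec fun x => 8 * f x + k + 2 :=
  Primrec.nat_add.comp (Primrec.nat_add.comp (Primrec.nat_mul.comp (Primrec.const 8) hf)
    (Primrec.const k)) (Primrec.const 2)

theorem primrec_freeze : Primrec (freeze : Formula op → Formula op) :=
  Primrec.encode_iff.1 (primrec_eight_mul_add Primrec.encode 2)

theorem primrec_globally : Primrec (globally : Formula op → Formula op) :=
  Primrec.encode_iff.1 (primrec_eight_mul_add Primrec.encode 4)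

theorem primrec_and_left (ψ : Formula op) : Primrec fun φ => and ψ φ :=
  Primrec.encode_iff.1 (primrec_eight_mul_add
    (Primrec₂.natPair.comp (Primrec.const (Encodable.encode ψ)) Primrec.encode) 6)

theorem primrec_or_left (ψ : Formula op) : Primrec fun φ => or ψ φ :=
  Primrec.encode_iff.1 (primrec_eight_mul_add
    (Primrec₂.natPair.comp (Primrec.const (Encodable.encode ψ)) Primrec.encode) 7)

end Formula

namespace CounterGraph

open Formula RunLetter

variable {Λ : Type} [Fintype Λ] (G : CounterGraph Λ)

theorem primrec_formula (op : DataQuantifier) : Primrec (G.formula : ℕ → Formula op) := by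
  refine (primrec_and_left _).comp ?_
  have hstep : Primrec fun φ : Formula op => Formula.and (sym (· = visit G.init))
      (freeze (globally (imp (Λ := Λ) IsVisit (.or (here G.init) (.or (noLinkAhead G.init) φ))))) :=
    (primrec_and_left _).comp (primrec_freeze.comp (primrec_globally.comp
      ((primrec_or_left _).comp ((primrec_or_left _).comp (primrec_or_left _)))))
  refine (Primrec.nat_rec₁ (G.input 0) (hstep.comp Primrec.snd).to₂).of_eq fun n => ?_
  induction n with
  | zero => rfl
  | succ n ih => simp only [input, ← ih]

end CounterGraph

theorem not_computablePred_satProblem (D : Type*) [Infinite D] (op : DataQuantifier) :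
    ¬ ComputablePred (SatProblem D op) := by
  intro h
  obtain ⟨Λ, _, G, hG⟩ := exists_counterGraph_not_computablePred_halts
  refine hG (ComputablePred.computable_of_manyOneReducible (q := SatProblem D op) ?_ h)
  exact ⟨fun n => (RunLetter.num Λ, G.formula n),
    (Computable.const _).pair (G.primrec_formula op).to_comp,
    fun n => CounterGraph.satProblem_formula_iff.symm⟩

end RegLTL

theorem mainTheorem6 (D : Type*) [Infinite D] :
    ¬ ComputablePred (RegLTL.SatProblem D .existsPast) ∧
      ¬ ComputablePred (RegLTL.SatProblem D .forallFuture) :=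
  ⟨RegLTL.not_computablePred_satProblem D _, RegLTL.not_computablePred_satProblem D _⟩
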